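/- Let $n\ge 2$, $0<T<\infty$, let $M$ be a compact smooth manifold of dimension $n-1$, and let $\varphi^*:M\times[0,T)\to\mathbb{R}^n$ be a smooth map such that for every $t\in[0,T)$ the map $\varphi^*(\cdot,t)$ is a smooth embedding of $M$ onto the boundary of a smooth, strictly convex body (compact, convex, with positive definite second fundamental form of the boundary) that contains the origin in its interior. Let $\nu^*(\cdot,t)$ be the outer unit normal and $\mathcal K^*(\cdot,t)>0$ the Gauss curvature of this boundary, and suppose that on $M\times[0,T)$ $$\partial_t\varphi^*=\frac{\langle\varphi^*,\nu^*\rangle^{n+2}}{\|\varphi^*\|^{n}}\,\frac{1}{\mathcal K^*}\,\nu^* .$$ Assume that $\gamma\|\varphi^*\|\le\langle\varphi^*,\nu^*\rangle$ on $M\times[0,T)$ for some $0<\gamma\le 1$. For $\lambda\in\mathbb{R}$ put $$\chi_\lambda=\|\varphi^*\|^{n+1}-\lambda\,\frac{\langle\varphi^*,\nu^*\rangle^{n+2}}{\|\varphi^*\|^{n}}\,\frac1{\mathcal K^*},\qquad \Lambda(n,\gamma)=\left(\frac{2n^2+5n+2}{(n-1)\,\gamma^{\frac{4n+8}{n-1}+2n+4}}\right)^{n-1}.$$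 Then for every $\lambda\ge\Lambda(n,\gamma)$ such that $\chi_\lambda<0$ on $M$ at time $t=0$, one has $$\|\varphi^*\|^{n-1}\le\frac{\lambda}{\mathcal K^*}\qquad\text{on } M\times[0,T).$$ Moreover, such $\lambda$ exist; in particular there is $\lambda\ge\Lambda(n,\gamma)$ with $\|\varphi^*\|^{n-1}\le\lambda/\mathcal K^*$ on $M\times[0,T)$. -/

import Mathlib

open Set
open scoped Manifold ContDiff RealInnerProductSpace

noncomputable section

namespace DualFlow

variable {n : ℕ} {M : Type*} [TopologicalSpace M]
  [ChartedSpace (EuclideanSpace ℝ (Fin (n - 1))) M]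

/-- The differential at `x` of a map `f : M → ℝⁿ`, applied to a tangent vector `v`. -/
def diff (f : M → EuclideanSpace ℝ (Fin n)) (x : M)
    (v : TangentSpace (𝓡 (n - 1)) x) : EuclideanSpace ℝ (Fin n) :=
  mfderiv (𝓡 (n - 1)) 𝓘(ℝ, EuclideanSpace ℝ (Fin n)) f x v

/-- The `i`-th coordinate tangent vector at `x`. -/
def coordVec (x : M) (i : Fin (n - 1)) : TangentSpace (𝓡 (n - 1)) x :=
  (EuclideanSpace.single i (1 : ℝ) : EuclideanSpace ℝ (Fin (n - 1)))

/-- The matrix `g_ij = ⟨∂_i f, ∂_j f⟩` of the first fundamental form. -/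
def firstForm (f : M → EuclideanSpace ℝ (Fin n)) (x : M) : Matrix (Fin (n - 1)) (Fin (n - 1)) ℝ :=
  Matrix.of fun i j => ⟪diff f x (coordVec x i), diff f x (coordVec x j)⟫

/-- The matrix `h_ij = ⟨∂_i f, ∂_j ν⟩` of the second fundamental form with respect to the
unit normal `ν` (positive for the unit sphere with its outer normal). -/
def secondForm (f ν : M → EuclideanSpace ℝ (Fin n)) (x : M) : Matrix (Fin (n - 1)) (Fin (n - 1)) ℝ :=
  Matrix.of fun i j => ⟪diff f x (coordVec x i), diff ν x (coordVec x j)⟫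

/-- Gauss curvature `det h_ij / det g_ij`; the quotient does not depend on the coordinates. -/
def gaussCurvature (f ν : M → EuclideanSpace ℝ (Fin n)) (x : M) : ℝ :=
  (secondForm f ν x).det / (firstForm f x).det

/-- `f : M → ℝⁿ` is a smooth embedding of the (compact) manifold `M` onto the boundary of a
smooth, strictly convex body containing the origin in its interior, and `ν` is the outer unit
normal along `f`. Strict convexity means that the second fundamental form is positive definite.
(For compact `M` an injective immersion is an embedding.) -/
structure IsStrictlyConvexBoundary (f ν : M → EuclideanSpace ℝ (Fin n)) : Prop where
  smooth : ContMDiff (𝓡 (n - 1)) 𝓘(ℝ, EuclideanSpace ℝ (Fin n)) ∞ f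
  injective : Function.Injective f
  immersion : ∀ x, Function.Injective (mfderiv (𝓡 (n - 1)) 𝓘(ℝ, EuclideanSpace ℝ (Fin n)) f x)
  body : ∃ K : ConvexBody (EuclideanSpace ℝ (Fin n)),
    0 ∈ interior (K : Set (EuclideanSpace ℝ (Fin n))) ∧
    range f = frontier (K : Set (EuclideanSpace ℝ (Fin n))) ∧
    ∀ x, ‖ν x‖ = 1 ∧ ∀ y ∈ K, ⟪y - f x, ν x⟫ ≤ 0
  strictly_convex : ∀ x (v : TangentSpace (𝓡 (n - 1)) x), v ≠ 0 → 0 < ⟪diff f x v, diff ν x v⟫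

/-- The speed `(⟨f, ν⟩ ^ (n + 2) / ‖f‖ ^ n) * (1 / K)` of the dual flow. -/
def speed (f ν : M → EuclideanSpace ℝ (Fin n)) (x : M) : ℝ :=
  ⟪f x, ν x⟫ ^ (n + 2) / ‖f x‖ ^ n * (1 / gaussCurvature f ν x)

/-- `φ : M × [0, T) → ℝⁿ`, with outer unit normal `ν`, is a smooth solution of the dual flow
`∂_t φ = (⟨φ, ν⟩ ^ (n + 2) / ‖φ‖ ^ n) (1 / K) ν` by boundaries of smooth, strictly convex bodies
with the origin in their interior. At `t = 0` the time derivative is one-sided. -/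
structure IsDualFlow (T : ℝ) (φ ν : M → ℝ → EuclideanSpace ℝ (Fin n)) : Prop where
  smooth : ContMDiffOn ((𝓡 (n - 1)).prod 𝓘(ℝ, ℝ)) 𝓘(ℝ, EuclideanSpace ℝ (Fin n)) ∞
    (fun p : M × ℝ => φ p.1 p.2) (univ ×ˢ Ico 0 T)
  convex : ∀ t ∈ Ico 0 T, IsStrictlyConvexBoundary (fun x => φ x t) (fun x => ν x t)
  flow : ∀ t ∈ Ico 0 T, ∀ x, HasDerivWithinAt (fun τ => φ x τ)
    (speed (fun y => φ y t) (fun y => ν y t) x • ν x t) (Ico 0 T) t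

/-- `χ = ‖f‖ ^ (n + 1) - lam * (⟨f, ν⟩ ^ (n + 2) / ‖f‖ ^ n) * (1 / K)`. -/
def chi (lam : ℝ) (f ν : M → EuclideanSpace ℝ (Fin n)) (x : M) : ℝ :=
  ‖f x‖ ^ (n + 1) - lam * speed f ν x

/-- The constant `((2n² + 5n + 2) / ((n - 1) γ ^ ((4n + 8)/(n - 1) + 2n + 4))) ^ (n - 1)`. -/
def threshold (n : ℕ) (γ : ℝ) : ℝ :=
  ((2 * (n : ℝ) ^ 2 + 5 * n + 2) /
    (((n : ℝ) - 1) * γ ^ ((4 * (n : ℝ) + 8) / ((n : ℝ) - 1) + 2 * n + 4))) ^ (n - 1)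

end DualFlow

end

/-! Write r = ‖φ‖, u = ⟪φ, ν⟫, S for the speed, K for the Gauss curvature and H for the mean
curvature, the trace of g⁻¹h. It suffices that χ = r^(n+1) - λS stays negative: since u ≤ r, one has
S ≤ r²/K, so χ < 0 gives r^(n+1) ≤ λr²/K, and r² cancels. Negativity is a maximum principle. By
compactness a violation has a first time, positive by the initial condition. At a zero of χ at that
time, S touches r^(n+1)/λ from above: the spatial gradients agree, the Hessian of the difference is
nonnegative and its time derivative is nonpositive. The evolution equations are ∂ₜg = 2Sh, ∂ₜν = -∇S
and ∂ₜh = S h g⁻¹ h - Hess S. Inserting them into the logarithmic time derivative of S rⁿ det h =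
u^(n+2) det g leaves H ≤ n(n+2)/u (`IsNormalFlow.trace_le_of_touching`). On the other hand χ = 0
says K r^(2n+1) = λ u^(n+2), while the arithmetic-geometric mean inequality gives (n-1)^(n-1) K ≤
H^(n-1) (`card_pow_mul_det_div_det_le`). With γr ≤ u these force (n-1)^(n-1) γ^(2n+1) λ ≤
(n(n+2))^(n-1) (`mul_le_of_trace_le`), which is false for λ ≥ Λ(n, γ)
(`pow_lt_mul_of_threshold_le`). The remaining work is regularity: ν and S are smooth up to t = 0,
and the intrinsic quantities agree with those computed in charts. -/

namespace DualFlow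

open Filter Topology Matrix

/-! ### Determinants, traces and positive matrices. -/

section LinearAlgebra

variable {ι : Type*} [Fintype ι] [DecidableEq ι]

/-- Jacobi's formula for the derivative of a determinant at an invertible matrix. -/
theorem hasDerivAt_det {A : ℝ → Matrix ι ι ℝ} {A' : Matrix ι ι ℝ} {t : ℝ}
    (hA : ∀ i j, HasDerivAt (fun s => A s i j) (A' i j) t) (hdet : (A t).det ≠ 0) :
    HasDerivAt (fun s => (A s).det) ((A t).det * ((A t)⁻¹ * A').trace) t := by
  have hrow : HasDerivAt (fun s => (fun i => A s i : ι → ι → ℝ)) (fun i => A' i) t :=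
    hasDerivAt_pi.2 fun i => hasDerivAt_pi.2 fun j => hA i j
  let D : ContinuousMultilinearMap ℝ (fun _ : ι => ι → ℝ) ℝ :=
    { (Matrix.detRowAlternating (R := ℝ) (n := ι)).toMultilinearMap with
      cont := by
        change Continuous fun B : Matrix ι ι ℝ => B.det
        exact continuous_id.matrix_det }
  have h := (D.hasFDerivAt (fun i => A t i)).comp_hasDerivAt t hrow
  -- The differential of a multilinear map sums the determinants with one row replaced; by Cramer's
  -- rule this sum is a trace against the adjugate.
  have hval : D.linearDeriv (fun i => A t i) (fun i => A' i) =
      (A t).det * ((A t)⁻¹ * A').trace := by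
    rw [ContinuousMultilinearMap.linearDeriv_apply]
    have h1 : ∀ i, D (Function.update (fun i => A t i) i (A' i)) =
        ((A t).updateRow i (A' i)).det := fun i => rfl
    have hu : IsUnit (A t).det := isUnit_iff_ne_zero.2 hdet
    have h2 : (A t).det * ((A t)⁻¹ * A').trace = ((A t).adjugate * A').trace := by
      rw [Matrix.inv_def, Matrix.smul_mul, Matrix.trace_smul, smul_eq_mul, ← mul_assoc,
        Ring.mul_inverse_cancel _ hu, one_mul]
    rw [h2, Matrix.trace_mul_comm, Matrix.trace]
    refine Finset.sum_congr rfl fun i _ => ?_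
    rw [h1, ← Matrix.cramer_transpose_apply, Matrix.cramer_eq_adjugate_mulVec,
      ← Matrix.adjugate_transpose, Matrix.diag_apply, Matrix.mul_apply, Matrix.mulVec, dotProduct]
    exact Finset.sum_congr rfl fun j _ => by rw [Matrix.transpose_apply, mul_comm]
  rw [hval] at h
  exact h

open scoped MatrixOrder in
/-- A positive semidefinite matrix is a Gram matrix. -/
theorem exists_eq_conjTranspose_mul_self {A : Matrix ι ι ℝ} (hA : A.PosSemidef) :
    ∃ B : Matrix ι ι ℝ, A = Bᴴ * B :=
  CStarAlgebra.nonneg_iff_eq_star_mul_self.1 (Matrix.nonneg_iff_posSemidef.2 hA)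

/-- With A = Cᴴ C, cyclicity turns the trace into that of C B Cᴴ, which is positive semidefinite. -/
theorem trace_mul_nonneg {A B : Matrix ι ι ℝ} (hA : A.PosSemidef) (hB : B.PosSemidef) :
    0 ≤ (A * B).trace := by
  obtain ⟨C, rfl⟩ := exists_eq_conjTranspose_mul_self hA
  rw [Matrix.mul_assoc, Matrix.trace_mul_comm]
  exact (hB.mul_mul_conjTranspose_same C).trace_nonneg

/-- The arithmetic-geometric mean inequality for the eigenvalues of `g⁻¹ h`. -/
theorem card_pow_mul_det_div_det_le {g h : Matrix ι ι ℝ} (hg : g.PosDef) (hh : h.PosDef)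
    [Nonempty ι] :
    (Fintype.card ι : ℝ) ^ Fintype.card ι * (h.det / g.det) ≤
      (g⁻¹ * h).trace ^ Fintype.card ι := by
  obtain ⟨B, hgB⟩ := exists_eq_conjTranspose_mul_self hg.inv.posSemidef
  -- The product g⁻¹h need not be symmetric; A is, and has the same trace and determinant.
  set A := B * h * Bᴴ with hA
  have hAp : A.PosSemidef := hh.posSemidef.mul_mul_conjTranspose_same B
  have htr : (g⁻¹ * h).trace = A.trace := by
    rw [hgB, hA, Matrix.mul_assoc, Matrix.trace_mul_comm]
  have hdet : h.det / g.det = A.det := by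
    have h1 : (g⁻¹).det = Bᴴ.det * B.det := by rw [hgB, Matrix.det_mul]
    rw [Matrix.det_nonsing_inv, Ring.inverse_eq_inv'] at h1
    rw [hA, Matrix.det_mul, Matrix.det_mul, div_eq_mul_inv, h1]; ring
  rw [htr, hdet, hAp.1.trace_eq_sum_eigenvalues, hAp.1.det_eq_prod_eigenvalues]
  simp only [RCLike.ofReal_real_eq_id, id_eq]
  have hc : (0 : ℝ) < Fintype.card ι := by exact_mod_cast Fintype.card_pos
  have ham := Real.geom_mean_le_arith_mean Finset.univ (fun _ => (1 : ℝ)) hAp.1.eigenvalues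
    (by simp) (by simpa using hc) fun i _ => hAp.eigenvalues_nonneg i
  simp only [Real.rpow_one, Finset.sum_const, Finset.card_univ, nsmul_eq_mul, mul_one,
    one_mul] at ham
  have hp : 0 ≤ ∏ i, hAp.1.eigenvalues i :=
    Finset.prod_nonneg fun i _ => hAp.eigenvalues_nonneg i
  have h := pow_le_pow_left₀ (Real.rpow_nonneg hp _) ham (Fintype.card ι)
  rw [← Real.rpow_natCast, ← Real.rpow_mul hp, inv_mul_cancel₀ hc.ne', Real.rpow_one, div_pow,
    le_div_iff₀ (pow_pos hc _)] at h
  rwa [mul_comm]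

end LinearAlgebra

/-! ### Second-order conditions and directional derivatives. -/

section Calculus

/-- The second derivative at a local minimum is nonnegative. -/
theorem second_deriv_nonneg_of_isLocalMin {g : ℝ → ℝ} {a : ℝ} (hg : ContinuousAt g a)
    (h : IsLocalMin g a) : 0 ≤ deriv (deriv g) a := by
  by_contra! hneg
  -- A negative second derivative would make the minimum a maximum as well, hence g locally
  -- constant.
  have hmax := isLocalMax_of_deriv_deriv_neg hneg h.deriv_eq_zero hg
  have hconst : g =ᶠ[𝓝 a] fun _ => g a := by
    filter_upwards [h, hmax] with x h1 h2 using le_antisymm h2 h1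
  have h2 : deriv g =ᶠ[𝓝 a] fun _ => 0 := by simpa using hconst.deriv
  rw [h2.deriv_eq] at hneg
  simp at hneg

end Calculus

section DirectionalDerivatives

variable {X Y : Type*} [NormedAddCommGroup X] [NormedSpace ℝ X]
  [NormedAddCommGroup Y] [NormedSpace ℝ Y]

theorem contDiffAt_fderiv_apply {f : X → Y} {p : X} (hf : ContDiffAt ℝ ∞ f p) (v : X) :
    ContDiffAt ℝ ∞ (fun x => fderiv ℝ f x v) p :=
  (hf.fderiv_right (m := ∞) (by simp)).clm_apply contDiffAt_const

theorem fderiv_fderiv_apply_comm {f : X → Y} {p : X} (hf : ContDiffAt ℝ ∞ f p) (v w : X) :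
    fderiv ℝ (fun x => fderiv ℝ f x v) p w = fderiv ℝ (fun x => fderiv ℝ f x w) p v := by
  have hd : DifferentiableAt ℝ (fderiv ℝ f) p :=
    (hf.fderiv_right (m := ∞) (by simp)).differentiableAt (by simp)
  have hs := hf.isSymmSndFDerivAt (by simpa using WithTop.coe_le_coe.2 (le_top (a := (2 : ℕ∞)))) v w
  rw [fderiv_clm_apply hd (differentiableAt_const v), fderiv_clm_apply hd (differentiableAt_const w)]
  simpa using hs.symm

theorem fderiv_norm_apply {Z : Type*} [NormedAddCommGroup Z] [InnerProductSpace ℝ Z]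
    {f : X → Z} {p : X} (hf : DifferentiableAt ℝ f p) (h0 : f p ≠ 0) (w : X) :
    fderiv ℝ (fun x => ‖f x‖) p w = ⟪f p, fderiv ℝ f p w⟫ / ‖f p‖ := by
  have hn : DifferentiableAt ℝ (fun x => ‖f x‖) p := hf.norm ℝ h0
  have h1 : fderiv ℝ (fun x => ‖f x‖ * ‖f x‖) p w = fderiv ℝ (fun x => ⟪f x, f x⟫) p w := by
    simp only [real_inner_self_eq_norm_mul_norm]
  rw [fderiv_inner_apply ℝ hf hf, fderiv_fun_mul hn hn] at h1
  simp only [_root_.add_apply, _root_.smul_apply, smul_eq_mul] at h1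
  rw [real_inner_comm (f p) (fderiv ℝ f p w)] at h1
  rw [eq_div_iff (norm_ne_zero_iff.2 h0)]
  linarith

theorem hasDerivAt_prodMk_right {a : X × ℝ → Y} {p : X × ℝ} (ha : DifferentiableAt ℝ a p) :
    HasDerivAt (fun s => a (p.1, s)) (fderiv ℝ a p (0, 1)) p.2 := by
  have h1 : HasDerivAt (fun s : ℝ => (p.1, s)) ((0 : X), (1 : ℝ)) p.2 :=
    (hasDerivAt_const _ _).prodMk (hasDerivAt_id _)
  exact HasFDerivAt.comp_hasDerivAt (l := a) p.2 ha.hasFDerivAt h1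

/-- At a minimum in the first variable, the second derivatives in that variable are
nonnegative. -/
theorem fderiv_fderiv_nonneg_of_isLocalMin {a : X × ℝ → ℝ} {p : X × ℝ} (ha : ContDiffAt ℝ ∞ a p)
    (hmin : IsLocalMin (fun x => a (x, p.2)) p.1) (v : X) :
    0 ≤ fderiv ℝ (fun x => fderiv ℝ a x (v, 0)) p (v, 0) := by
  let c : ℝ → X × ℝ := fun s => (p.1 + s • v, p.2)
  have hc0 : c 0 = p := by simp [c]
  have hc : ∀ s, HasDerivAt c (v, 0) s := fun s => by
    have h := (((hasDerivAt_id s).smul_const v).const_add p.1).prodMk (hasDerivAt_const s p.2)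
    simpa [c] using h
  have hcc : ContinuousAt c 0 := (hc 0).continuousAt
  have hev : ∀ᶠ s in 𝓝 (0 : ℝ), ContDiffAt ℝ 1 a (c s) := by
    have h1 : ∀ᶠ x in 𝓝 p, ContDiffAt ℝ 1 a x :=
      (ha.of_le (by exact_mod_cast le_top)).eventually (by simp)
    rw [← hc0] at h1
    exact hcc.eventually h1
  have hd1 : deriv (fun s => a (c s)) =ᶠ[𝓝 0] fun s => fderiv ℝ a (c s) (v, 0) := by
    filter_upwards [hev] with s hs
    exact ((hs.differentiableAt (by simp)).hasFDerivAt.comp_hasDerivAt s (hc s)).deriv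
  have hd2 : deriv (deriv fun s => a (c s)) 0 =
      fderiv ℝ (fun x => fderiv ℝ a x (v, 0)) p (v, 0) := by
    rw [hd1.deriv_eq]
    have h2 : HasFDerivAt (fun x => fderiv ℝ a x (v, 0))
        (fderiv ℝ (fun x => fderiv ℝ a x (v, 0)) (c 0)) (c 0) := by
      rw [hc0]
      exact ((contDiffAt_fderiv_apply ha _).differentiableAt (by simp)).hasFDerivAt
    have h3 := (h2.comp_hasDerivAt 0 (hc 0)).deriv
    rwa [hc0] at h3
  rw [← hd2]
  apply second_deriv_nonneg_of_isLocalMin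
  · exact ContinuousAt.comp (by rw [hc0]; exact ha.continuousAt) hcc
  · have ht : Tendsto (fun s : ℝ => p.1 + s • v) (𝓝 0) (𝓝 p.1) := by
      have : Continuous fun s : ℝ => p.1 + s • v := by fun_prop
      simpa using this.tendsto 0
    filter_upwards [ht.eventually hmin] with s hs
    simpa [c] using hs

end DirectionalDerivatives

/-! ### Fundamental forms as Gram-type matrices. -/

section LinearAlgebra

variable {ι : Type*} [Fintype ι]
  {F E : Type*} [AddCommGroup F] [Module ℝ F] [NormedAddCommGroup E] [InnerProductSpace ℝ E]

/-- The matrix `⟪P bᵢ, Q bⱼ⟫` of a pair of linear maps into a Euclidean space. -/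
def pairing (b : ι → F) (P Q : F → E) : Matrix ι ι ℝ := Matrix.of fun i j => ⟪P (b i), Q (b j)⟫

theorem dotProduct_pairing_mulVec (b : ι → F) (P Q : F →ₗ[ℝ] E) (x : ι → ℝ) :
    x ⬝ᵥ (pairing b P Q *ᵥ x) = ⟪P (∑ i, x i • b i), Q (∑ i, x i • b i)⟫ := by
  simp only [map_sum, map_smul, sum_inner, inner_sum, real_inner_smul_left, real_inner_smul_right,
    dotProduct, mulVec, pairing, Matrix.of_apply, Finset.mul_sum]
  rw [Finset.sum_comm]
  exact Finset.sum_congr rfl fun i _ => Finset.sum_congr rfl fun j _ => by ring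

theorem posDef_pairing (b : Module.Basis ι ℝ F) (P Q : F →ₗ[ℝ] E)
    (hsymm : ∀ v w, ⟪P v, Q w⟫ = ⟪P w, Q v⟫) (hpos : ∀ v, v ≠ 0 → 0 < ⟪P v, Q v⟫) :
    (pairing b P Q).PosDef := by
  refine Matrix.PosDef.of_dotProduct_mulVec_pos ?_ fun x hx => ?_
  · ext i j
    simpa [pairing] using hsymm (b j) (b i)
  · rw [star_trivial, dotProduct_pairing_mulVec]
    refine hpos _ fun h0 => hx ?_
    funext i
    exact Fintype.linearIndependent_iff.1 b.linearIndependent x h0 i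

theorem pairing_comp [DecidableEq ι] (b : Module.Basis ι ℝ F) (P Q : F →ₗ[ℝ] E) (A : F →ₗ[ℝ] F) :
    pairing b (P ∘ₗ A) (Q ∘ₗ A) =
      (LinearMap.toMatrix b b A)ᵀ * pairing b P Q * LinearMap.toMatrix b b A := by
  have hA : ∀ j, A (b j) = ∑ k, LinearMap.toMatrix b b A k j • b k := fun j => by
    simp only [LinearMap.toMatrix_apply]
    exact (b.sum_repr (A (b j))).symm
  ext i j
  simp only [pairing, Matrix.of_apply, LinearMap.comp_apply, hA, map_sum, map_smul, sum_inner,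
    inner_sum, real_inner_smul_left, real_inner_smul_right, Matrix.mul_apply,
    Matrix.transpose_apply, Finset.sum_mul]
  exact Finset.sum_congr rfl fun k _ => Finset.sum_congr rfl fun l _ => by ring

/-- The curvature quotient `det ⟪P bᵢ, Q bⱼ⟫ / det ⟪P bᵢ, P bⱼ⟫` is coordinate independent. -/
theorem det_pairing_comp_div [DecidableEq ι] (b : Module.Basis ι ℝ F) (P Q : F →ₗ[ℝ] E) (A : F →ₗ[ℝ] F)
    (hA : Function.Bijective A) :
    (pairing b (P ∘ₗ A) (Q ∘ₗ A)).det / (pairing b (P ∘ₗ A) (P ∘ₗ A)).det =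
      (pairing b P Q).det / (pairing b P P).det := by
  have hu : LinearMap.det A ≠ 0 :=
    (LinearEquiv.isUnit_det' (LinearEquiv.ofBijective A hA)).ne_zero
  rw [pairing_comp, pairing_comp]
  simp only [Matrix.det_mul, Matrix.det_transpose, LinearMap.det_toMatrix]
  rw [mul_assoc, mul_assoc, mul_div_mul_left _ _ hu, mul_div_mul_right _ _ hu]

/-- The tangent space has codimension one and lies in ν⊥, so the two coincide. -/
theorem mem_range_of_inner_eq_zero [FiniteDimensional ℝ E] [FiniteDimensional ℝ F]
    (hdim : Module.finrank ℝ E = Module.finrank ℝ F + 1) {P : F →ₗ[ℝ] E}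
    (hP : Function.Injective P) {ν : E} (hν : ν ≠ 0) (hperp : ∀ v, ⟪P v, ν⟫ = 0) {y : E}
    (hy : ⟪y, ν⟫ = 0) : y ∈ LinearMap.range P := by
  have hle : LinearMap.range P ≤ (ℝ ∙ ν)ᗮ := by
    rintro _ ⟨v, rfl⟩
    rw [Submodule.mem_orthogonal_singleton_iff_inner_left]
    exact hperp v
  have heq : LinearMap.range P = (ℝ ∙ ν)ᗮ := by
    apply Submodule.eq_of_le_of_finrank_eq hle
    rw [LinearMap.finrank_range_of_inj hP]
    have h1 := (ℝ ∙ ν).finrank_add_finrank_orthogonal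
    rw [finrank_span_singleton hν, hdim] at h1
    omega
  rw [heq, Submodule.mem_orthogonal_singleton_iff_inner_left]
  exact hy

/-- `⟪Qᵢ, Qⱼ⟫ = h g⁻¹ h` if `Q` takes values in the range of `P`. -/
theorem pairing_self_eq [DecidableEq ι] (b : Module.Basis ι ℝ F) (P Q : F →ₗ[ℝ] E)
    (hsymm : ∀ v w, ⟪P v, Q w⟫ = ⟪P w, Q v⟫) (hQ : ∀ v, Q v ∈ LinearMap.range P)
    (hg : (pairing b P P).det ≠ 0) :
    pairing b Q Q = pairing b P Q * (pairing b P P)⁻¹ * pairing b P Q := by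
  choose c hc using fun i => hQ (b i)
  have hQe : ∀ i, Q (b i) = ∑ k, b.repr (c i) k • P (b k) := fun i => by
    have h := congrArg P (b.sum_repr (c i))
    rw [map_sum, hc i] at h
    simpa only [map_smul] using h.symm
  -- The rows of a are the coordinates of the Weingarten map, so h = a g and ⟪Qᵢ, Qⱼ⟫ = a h.
  let a : Matrix ι ι ℝ := Matrix.of fun i k => b.repr (c i) k
  have h1 : pairing b P Q = a * pairing b P P := by
    ext i j
    simp only [pairing, Matrix.of_apply, Matrix.mul_apply, a]
    rw [hsymm, hQe i, inner_sum]
    exact Finset.sum_congr rfl fun k _ => by rw [real_inner_smul_right, real_inner_comm]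
  have h2 : pairing b Q Q = a * pairing b P Q := by
    ext i j
    simp only [pairing, Matrix.of_apply, Matrix.mul_apply, a]
    rw [hQe i, sum_inner]
    exact Finset.sum_congr rfl fun k _ => by rw [real_inner_smul_left]
  have h3 : a = pairing b P Q * (pairing b P P)⁻¹ := by
    rw [h1, Matrix.mul_nonsing_inv_cancel_right _ _ (isUnit_iff_ne_zero.2 hg)]
  rw [h2, ← h3]

/-- The trace form of the evolution inequality of the Gauss curvature. -/
theorem trace_sub_trace_le [DecidableEq ι] {g h C Ψ : Matrix ι ι ℝ} (hh : h.PosDef)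
    (hΨ : Ψ.PosSemidef) (hC : C = h * g⁻¹ * h) (S c : ℝ) :
    (h⁻¹ * (S • C - Ψ + c • h)).trace - (g⁻¹ * ((2 * S) • h)).trace ≤
      -S * (g⁻¹ * h).trace + Fintype.card ι * c := by
  have hu : IsUnit h.det := isUnit_iff_ne_zero.2 hh.det_pos.ne'
  have h1 : (h⁻¹ * C) = g⁻¹ * h := by
    rw [hC, Matrix.mul_assoc, Matrix.nonsing_inv_mul_cancel_left _ _ hu]
  -- Only the sign of the Hessian term Ψ matters; the two other contributions are SH and -2SH.
  have h2 : 0 ≤ (h⁻¹ * Ψ).trace := trace_mul_nonneg hh.inv.posSemidef hΨ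
  rw [Matrix.mul_add, Matrix.mul_sub, Matrix.mul_smul, Matrix.mul_smul, Matrix.mul_smul, h1,
    Matrix.nonsing_inv_mul _ hu]
  simp only [Matrix.trace_add, Matrix.trace_sub, Matrix.trace_smul, Matrix.trace_one, smul_eq_mul]
  linarith

end LinearAlgebra

/-! ### Evolution equations for a hypersurface moving with normal speed. -/

section LocalFlow

variable {F E : Type*} [NormedAddCommGroup F] [NormedSpace ℝ F]
  [NormedAddCommGroup E] [InnerProductSpace ℝ E]

/-- The derivative in the first variable. -/
noncomputable def spatialDeriv (f : F × ℝ → E) (p : F × ℝ) : F →ₗ[ℝ] E :=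
  ((fderiv ℝ f p).comp (ContinuousLinearMap.inl ℝ F ℝ)).toLinearMap

theorem spatialDeriv_apply (f : F × ℝ → E) (p : F × ℝ) (v : F) :
    spatialDeriv f p v = fderiv ℝ f p (v, 0) := rfl

/-- A smooth family of parametrized hypersurfaces with unit normal `ν`, moving with normal
speed `S`. -/
structure IsNormalFlow (W : Set (F × ℝ)) (f ν : F × ℝ → E) (S : F × ℝ → ℝ) : Prop where
  isOpen : IsOpen W
  contDiffAt_map : ∀ p ∈ W, ContDiffAt ℝ ∞ f p
  contDiffAt_normal : ∀ p ∈ W, ContDiffAt ℝ ∞ ν p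
  contDiffAt_speed : ∀ p ∈ W, ContDiffAt ℝ ∞ S p
  norm_normal : ∀ p ∈ W, ‖ν p‖ = 1
  inner_normal : ∀ p ∈ W, ∀ v, ⟪fderiv ℝ f p (v, 0), ν p⟫ = 0
  flow : ∀ p ∈ W, fderiv ℝ f p (0, 1) = S p • ν p

namespace IsNormalFlow

variable {W : Set (F × ℝ)} {f ν : F × ℝ → E} {S : F × ℝ → ℝ} {p : F × ℝ}

theorem differentiableAt_map (H : IsNormalFlow W f ν S) (hp : p ∈ W) : DifferentiableAt ℝ f p :=
  (H.contDiffAt_map p hp).differentiableAt (by simp)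

theorem differentiableAt_normal (H : IsNormalFlow W f ν S) (hp : p ∈ W) :
    DifferentiableAt ℝ ν p :=
  (H.contDiffAt_normal p hp).differentiableAt (by simp)

theorem differentiableAt_speed (H : IsNormalFlow W f ν S) (hp : p ∈ W) :
    DifferentiableAt ℝ S p :=
  (H.contDiffAt_speed p hp).differentiableAt (by simp)

theorem differentiableAt_fderiv_map (H : IsNormalFlow W f ν S) (hp : p ∈ W) (w : F × ℝ) :
    DifferentiableAt ℝ (fun x => fderiv ℝ f x w) p :=
  (contDiffAt_fderiv_apply (H.contDiffAt_map p hp) w).differentiableAt (by simp)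

theorem differentiableAt_fderiv_normal (H : IsNormalFlow W f ν S) (hp : p ∈ W) (w : F × ℝ) :
    DifferentiableAt ℝ (fun x => fderiv ℝ ν x w) p :=
  (contDiffAt_fderiv_apply (H.contDiffAt_normal p hp) w).differentiableAt (by simp)

theorem inner_fderiv_normal (H : IsNormalFlow W f ν S) (hp : p ∈ W) (w : F × ℝ) :
    ⟪fderiv ℝ ν p w, ν p⟫ = 0 := by
  have hν := H.differentiableAt_normal hp
  have h1 : (fun x => ⟪ν x, ν x⟫) =ᶠ[𝓝 p] fun _ => (1 : ℝ) := by
    filter_upwards [H.isOpen.mem_nhds hp] with x hx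
    rw [real_inner_self_eq_norm_sq, H.norm_normal x hx, one_pow]
  have h2 := fderiv_inner_apply ℝ hν hν w
  rw [h1.fderiv_eq, real_inner_comm] at h2
  simp only [fderiv_fun_const, Pi.zero_apply, _root_.zero_apply] at h2
  linarith

/-- Differentiate ⟪∂ᵥf, ν⟫ = 0. Spatial w gives the symmetry of h, and w = ∂ₜ gives the evolution of
ν. -/
theorem inner_fderiv_fderiv (H : IsNormalFlow W f ν S) (hp : p ∈ W) (v : F) (w : F × ℝ) :
    ⟪fderiv ℝ f p (v, 0), fderiv ℝ ν p w⟫ =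
      -⟪fderiv ℝ (fun x => fderiv ℝ f x (v, 0)) p w, ν p⟫ := by
  have h1 : (fun x => ⟪fderiv ℝ f x (v, 0), ν x⟫) =ᶠ[𝓝 p] fun _ => (0 : ℝ) := by
    filter_upwards [H.isOpen.mem_nhds hp] with x hx using H.inner_normal x hx v
  have h2 := fderiv_inner_apply ℝ (H.differentiableAt_fderiv_map hp (v, 0))
    (H.differentiableAt_normal hp) w
  rw [h1.fderiv_eq] at h2
  simp only [fderiv_fun_const, Pi.zero_apply, _root_.zero_apply] at h2
  linarith

theorem second_form_symm (H : IsNormalFlow W f ν S) (hp : p ∈ W) (v w : F) :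
    ⟪fderiv ℝ f p (v, 0), fderiv ℝ ν p (w, 0)⟫ = ⟪fderiv ℝ f p (w, 0), fderiv ℝ ν p (v, 0)⟫ := by
  rw [H.inner_fderiv_fderiv hp, H.inner_fderiv_fderiv hp,
    fderiv_fderiv_apply_comm (H.contDiffAt_map p hp)]

theorem fderiv_fderiv_time (H : IsNormalFlow W f ν S) (hp : p ∈ W) (v : F) :
    fderiv ℝ (fun x => fderiv ℝ f x (v, 0)) p (0, 1) =
      S p • fderiv ℝ ν p (v, 0) + fderiv ℝ S p (v, 0) • ν p := by
  rw [fderiv_fderiv_apply_comm (H.contDiffAt_map p hp)]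
  have h1 : (fun x => fderiv ℝ f x (0, 1)) =ᶠ[𝓝 p] fun x => S x • ν x := by
    filter_upwards [H.isOpen.mem_nhds hp] with x hx using H.flow x hx
  rw [h1.fderiv_eq, fderiv_fun_smul (H.differentiableAt_speed hp) (H.differentiableAt_normal hp)]
  simp

/-- `∂ₜ ν` is minus the gradient of the speed. -/
theorem inner_fderiv_normal_time (H : IsNormalFlow W f ν S) (hp : p ∈ W) (v : F) :
    ⟪fderiv ℝ f p (v, 0), fderiv ℝ ν p (0, 1)⟫ = -fderiv ℝ S p (v, 0) := by
  rw [H.inner_fderiv_fderiv hp, H.fderiv_fderiv_time hp, inner_add_left, real_inner_smul_left,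
    real_inner_smul_left, H.inner_fderiv_normal hp, real_inner_self_eq_norm_sq,
    H.norm_normal p hp]
  ring

theorem fderiv_first_form_time (H : IsNormalFlow W f ν S) (hp : p ∈ W) (v w : F) :
    fderiv ℝ (fun x => ⟪fderiv ℝ f x (v, 0), fderiv ℝ f x (w, 0)⟫) p (0, 1) =
      2 * S p * ⟪fderiv ℝ f p (v, 0), fderiv ℝ ν p (w, 0)⟫ := by
  rw [fderiv_inner_apply ℝ (H.differentiableAt_fderiv_map hp _)
    (H.differentiableAt_fderiv_map hp _), H.fderiv_fderiv_time hp, H.fderiv_fderiv_time hp,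
    inner_add_left, inner_add_right, real_inner_smul_left, real_inner_smul_right,
    real_inner_smul_left, real_inner_smul_right, H.inner_normal p hp, real_inner_comm _ (ν p),
    H.inner_normal p hp, real_inner_comm _ (fderiv ℝ ν p (v, 0)), H.second_form_symm hp w v]
  ring

/-- Differentiating ⟪∂ᵥf, ∂ₜν⟫ = -∂ᵥS along w trades the mixed derivative of ν for a second
derivative of S. As ∂ₜν = -∇S, the last two terms together are minus the covariant Hessian of S, so
no Christoffel symbols appear. -/
theorem fderiv_second_form_time (H : IsNormalFlow W f ν S) (hp : p ∈ W) (v w : F) :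
    fderiv ℝ (fun x => ⟪fderiv ℝ f x (v, 0), fderiv ℝ ν x (w, 0)⟫) p (0, 1) =
      S p * ⟪fderiv ℝ ν p (v, 0), fderiv ℝ ν p (w, 0)⟫ -
        fderiv ℝ (fun x => fderiv ℝ S x (v, 0)) p (w, 0) -
        ⟪fderiv ℝ (fun x => fderiv ℝ f x (v, 0)) p (w, 0), fderiv ℝ ν p (0, 1)⟫ := by
  have h1 : (fun x => ⟪fderiv ℝ f x (v, 0), fderiv ℝ ν x (0, 1)⟫) =ᶠ[𝓝 p]
      fun x => -fderiv ℝ S x (v, 0) := by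
    filter_upwards [H.isOpen.mem_nhds hp] with x hx using H.inner_fderiv_normal_time hx v
  have h2 := fderiv_inner_apply ℝ (H.differentiableAt_fderiv_map hp (v, 0))
    (H.differentiableAt_fderiv_normal hp (0, 1)) (w, 0)
  rw [h1.fderiv_eq, fderiv_fun_neg, _root_.neg_apply] at h2
  rw [fderiv_inner_apply ℝ (H.differentiableAt_fderiv_map hp _)
    (H.differentiableAt_fderiv_normal hp _), H.fderiv_fderiv_time hp,
    fderiv_fderiv_apply_comm (H.contDiffAt_normal p hp) (w, 0) (0, 1), inner_add_left,
    real_inner_smul_left, real_inner_smul_left, real_inner_comm _ (ν p),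
    H.inner_fderiv_normal hp]
  linarith

end IsNormalFlow

end LocalFlow

/-! ### One-sided minima in time and derivatives of powers of the norm. -/

section Calculus

/-- Only slopes from the left are used: at a first touching time nothing is known about later times.
-/
theorem nonpos_of_hasDerivAt_of_min_left {g : ℝ → ℝ} {d t : ℝ} (hg : HasDerivAt g d t)
    (h : ∀ᶠ s in 𝓝 t, s ≤ t → g t ≤ g s) : d ≤ 0 := by
  have h1 : Tendsto (slope g t) (𝓝[<] t) (𝓝 d) :=
    (hasDerivWithinAt_iff_tendsto_slope' (by simp)).1 hg.hasDerivWithinAt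
  refine le_of_tendsto h1 ?_
  filter_upwards [nhdsWithin_le_nhds h, self_mem_nhdsWithin] with s hs hst
  have hst' : s < t := hst
  rw [slope_def_field]
  exact div_nonpos_of_nonneg_of_nonpos (sub_nonneg.2 (hs hst'.le)) (sub_nonpos.2 hst'.le)

variable {X E : Type*} [NormedAddCommGroup X] [NormedSpace ℝ X]
  [NormedAddCommGroup E] [InnerProductSpace ℝ E]

theorem fderiv_norm_pow_apply {f : X → E} {p : X} (hf : DifferentiableAt ℝ f p) (h0 : f p ≠ 0)
    (k : ℕ) (w : X) : fderiv ℝ (fun x => ‖f x‖ ^ k) p w =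
      k * ‖f p‖ ^ (k - 1) * (⟪f p, fderiv ℝ f p w⟫ / ‖f p‖) := by
  rw [fderiv_fun_pow _ (hf.norm ℝ h0)]
  simp only [_root_.smul_apply, nsmul_eq_mul, smul_eq_mul, fderiv_norm_apply hf h0]

theorem fderiv_norm_pow_add_two_div_apply {f : X → E} {p : X} (hf : DifferentiableAt ℝ f p)
    (h0 : f p ≠ 0) (k : ℕ) (lam : ℝ) (w : X) :
    fderiv ℝ (fun x => ‖f x‖ ^ (k + 2) / lam) p w =
      (k + 2) / lam * (‖f p‖ ^ k * ⟪f p, fderiv ℝ f p w⟫) := by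
  have hd : DifferentiableAt ℝ (fun x => ‖f x‖ ^ (k + 2)) p := (hf.norm ℝ h0).pow _
  have hr : ‖f p‖ ≠ 0 := norm_ne_zero_iff.2 h0
  simp only [div_eq_mul_inv]
  rw [fderiv_mul_const hd]
  simp only [_root_.smul_apply, smul_eq_mul, fderiv_norm_pow_apply hf h0]
  rw [show k + 2 - 1 = k + 1 from rfl, pow_succ]
  push_cast
  field_simp

/-- The exponent k + 2 is n + 1 for n = k + 1. The truncated k - 1 is harmless at k = 0 because of
the factor k. -/
theorem fderiv_fderiv_norm_pow_add_two_div_apply {f : X → E} {p : X} (hf : ContDiffAt ℝ ∞ f p)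
    (h0 : f p ≠ 0) (k : ℕ) (lam : ℝ) (v w : X) :
    fderiv ℝ (fun y => fderiv ℝ (fun x => ‖f x‖ ^ (k + 2) / lam) y v) p w =
      (k + 2) / lam * (k * ‖f p‖ ^ (k - 1) / ‖f p‖ * (⟪f p, fderiv ℝ f p v⟫ *
        ⟪f p, fderiv ℝ f p w⟫) + ‖f p‖ ^ k * (⟪fderiv ℝ f p v, fderiv ℝ f p w⟫ +
          ⟪f p, fderiv ℝ (fun x => fderiv ℝ f x v) p w⟫)) := by
  have hd : DifferentiableAt ℝ f p := hf.differentiableAt (by simp)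
  have hd1 : DifferentiableAt ℝ (fun x => fderiv ℝ f x v) p :=
    (contDiffAt_fderiv_apply hf v).differentiableAt (by simp)
  have hev : (fun y => fderiv ℝ (fun x => ‖f x‖ ^ (k + 2) / lam) y v) =ᶠ[𝓝 p]
      fun y => (k + 2) / lam * (‖f y‖ ^ k * ⟪f y, fderiv ℝ f y v⟫) := by
    have h1 : ∀ᶠ x in 𝓝 p, ContDiffAt ℝ 1 f x :=
      (hf.of_le (by exact_mod_cast le_top)).eventually (by simp)
    filter_upwards [h1, hf.continuousAt.eventually_ne h0] with y hy hy0
    exact fderiv_norm_pow_add_two_div_apply (hy.differentiableAt (by simp)) hy0 k lam v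
  have hn : DifferentiableAt ℝ (fun x => ‖f x‖ ^ k) p := (hd.norm ℝ h0).pow _
  have hi : DifferentiableAt ℝ (fun x => ⟪f x, fderiv ℝ f x v⟫) p := hd.inner ℝ hd1
  rw [hev.fderiv_eq, fderiv_const_mul (hn.fun_mul hi), fderiv_fun_mul hn hi]
  simp only [_root_.smul_apply, _root_.add_apply, smul_eq_mul, fderiv_norm_pow_apply hd h0,
    fderiv_inner_apply ℝ hd hd1]
  rw [real_inner_comm (fderiv ℝ f p v) (fderiv ℝ f p w)]
  ring

end Calculus

/-! ### The evolution equations at a touching point. -/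

namespace IsNormalFlow

variable {F E : Type*} [NormedAddCommGroup F] [NormedSpace ℝ F]
  [NormedAddCommGroup E] [InnerProductSpace ℝ E]
  {W : Set (F × ℝ)} {f ν : F × ℝ → E} {S : F × ℝ → ℝ} {p : F × ℝ} {lam : ℝ} {k : ℕ}

theorem contDiffAt_norm_pow_div (H : IsNormalFlow W f ν S) (hp : p ∈ W) (h0 : f p ≠ 0) :
    ContDiffAt ℝ ∞ (fun x => ‖f x‖ ^ (k + 2) / lam) p :=
  (((H.contDiffAt_map p hp).norm ℝ h0).pow _).div_const _

/-- The gradient of the speed at a point where it touches `‖f‖ ^ (k + 2) / lam`. -/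
theorem fderiv_speed_of_touching (H : IsNormalFlow W f ν S) (hp : p ∈ W) (h0 : f p ≠ 0)
    (hmin : IsLocalMin (fun y => S (y, p.2) - ‖f (y, p.2)‖ ^ (k + 2) / lam) p.1) (v : F) :
    fderiv ℝ S p (v, 0) = (k + 2) / lam * (‖f p‖ ^ k * ⟪f p, fderiv ℝ f p (v, 0)⟫) := by
  have hS := H.differentiableAt_speed hp
  have ha : DifferentiableAt ℝ (fun x => ‖f x‖ ^ (k + 2) / lam) p :=
    (H.contDiffAt_norm_pow_div hp h0).differentiableAt (by simp)
  have hi : HasFDerivAt (fun y : F => (y, p.2)) (ContinuousLinearMap.inl ℝ F ℝ) p.1 :=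
    hasFDerivAt_prodMk_left _ _
  have h1 := HasFDerivAt.comp (g := fun x => S x - ‖f x‖ ^ (k + 2) / lam) p.1
    (hS.sub ha).hasFDerivAt hi
  have h2 := congrArg (fun L => L v) (hmin.hasFDerivAt_eq_zero h1)
  rw [fderiv_sub hS ha] at h2
  simp only [ContinuousLinearMap.comp_apply, ContinuousLinearMap.inl_apply, _root_.sub_apply,
    _root_.zero_apply, fderiv_norm_pow_add_two_div_apply (H.differentiableAt_map hp) h0] at h2
  linarith

/-- This is ∂ₜν = -∇S with ∇S replaced by the gradient of the touching function. The difference y of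
the two sides is orthogonal to ν, hence tangent, and orthogonal to every tangent vector, hence to
itself. -/
theorem fderiv_normal_time_of_touching [FiniteDimensional ℝ E] [FiniteDimensional ℝ F]
    (H : IsNormalFlow W f ν S) (hp : p ∈ W)
    (h0 : f p ≠ 0) (hdim : Module.finrank ℝ E = Module.finrank ℝ F + 1)
    (hinj : Function.Injective (spatialDeriv f p))
    (hmin : IsLocalMin (fun y => S (y, p.2) - ‖f (y, p.2)‖ ^ (k + 2) / lam) p.1) :
    fderiv ℝ ν p (0, 1) = -((k + 2) / lam * ‖f p‖ ^ k) • (f p - ⟪f p, ν p⟫ • ν p) := by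
  have hν1 : ⟪ν p, ν p⟫ = 1 := by rw [real_inner_self_eq_norm_sq, H.norm_normal p hp, one_pow]
  have hν0 : ν p ≠ 0 := fun h => by simp [h] at hν1
  rw [← sub_eq_zero]
  set y := fderiv ℝ ν p (0, 1) - -((k + 2) / lam * ‖f p‖ ^ k) • (f p - ⟪f p, ν p⟫ • ν p) with hy
  have hyν : ⟪y, ν p⟫ = 0 := by
    simp only [hy, inner_sub_left, real_inner_smul_left, H.inner_fderiv_normal hp, hν1]
    ring
  obtain ⟨v, hv⟩ := mem_range_of_inner_eq_zero hdim hinj hν0 (H.inner_normal p hp) hyν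
  have hyv : ⟪fderiv ℝ f p (v, 0), y⟫ = 0 := by
    simp only [hy, inner_sub_right, real_inner_smul_right, H.inner_fderiv_normal_time hp,
      H.fderiv_speed_of_touching hp h0 hmin, H.inner_normal p hp,
      real_inner_comm (f p) (fderiv ℝ f p (v, 0))]
    ring
  rw [← spatialDeriv_apply, hv] at hyv
  exact inner_self_eq_zero.1 hyv

/-- The evolution of the second fundamental form at a point where the speed touches
`‖f‖ ^ (k + 2) / lam`. -/
theorem fderiv_second_form_of_touching [FiniteDimensional ℝ E] [FiniteDimensional ℝ F]
    (H : IsNormalFlow W f ν S) (hp : p ∈ W)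
    (h0 : f p ≠ 0) (hdim : Module.finrank ℝ E = Module.finrank ℝ F + 1)
    (hinj : Function.Injective (spatialDeriv f p))
    (hmin : IsLocalMin (fun y => S (y, p.2) - ‖f (y, p.2)‖ ^ (k + 2) / lam) p.1) (v w : F) :
    fderiv ℝ (fun x => ⟪fderiv ℝ f x (v, 0), fderiv ℝ ν x (w, 0)⟫) p (0, 1) =
      S p * ⟪fderiv ℝ ν p (v, 0), fderiv ℝ ν p (w, 0)⟫ -
        (fderiv ℝ (fun x => fderiv ℝ (fun x => S x - ‖f x‖ ^ (k + 2) / lam) x (v, 0)) p (w, 0) +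
          (k + 2) / lam * (k * ‖f p‖ ^ (k - 1) / ‖f p‖ * (⟪f p, fderiv ℝ f p (v, 0)⟫ *
            ⟪f p, fderiv ℝ f p (w, 0)⟫) +
              ‖f p‖ ^ k * ⟪fderiv ℝ f p (v, 0), fderiv ℝ f p (w, 0)⟫)) +
        (k + 2) / lam * ‖f p‖ ^ k * ⟪f p, ν p⟫ *
          ⟪fderiv ℝ f p (v, 0), fderiv ℝ ν p (w, 0)⟫ := by
  have hS := H.contDiffAt_speed p hp
  have ha := H.contDiffAt_norm_pow_div (k := k) (lam := lam) hp h0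
  have h1 : ∀ᶠ x in 𝓝 p, ContDiffAt ℝ 1 S x :=
    (hS.of_le (by exact_mod_cast le_top)).eventually (by simp)
  have h2 : ∀ᶠ x in 𝓝 p, ContDiffAt ℝ 1 (fun x => ‖f x‖ ^ (k + 2) / lam) x :=
    (ha.of_le (by exact_mod_cast le_top)).eventually (by simp)
  have h3 : (fun x => fderiv ℝ (fun x => S x - ‖f x‖ ^ (k + 2) / lam) x (v, 0)) =ᶠ[𝓝 p]
      fun x => fderiv ℝ S x (v, 0) -
        fderiv ℝ (fun x => ‖f x‖ ^ (k + 2) / lam) x (v, 0) := by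
    filter_upwards [h1, h2] with x hx1 hx2
    rw [fderiv_fun_sub (hx1.differentiableAt (by simp)) (hx2.differentiableAt (by simp)),
      _root_.sub_apply]
  -- The terms in ⟪f, ∂w∂ᵥf⟫ coming from the Hessian of the norm power and from ∂ₜν cancel; the
  -- normal part of ∂ₜν leaves a multiple of h.
  rw [h3.fderiv_eq, fderiv_fun_sub
    ((contDiffAt_fderiv_apply hS _).differentiableAt (by simp))
    ((contDiffAt_fderiv_apply ha _).differentiableAt (by simp)), _root_.sub_apply,
    fderiv_fderiv_norm_pow_add_two_div_apply (H.contDiffAt_map p hp) h0,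
    H.fderiv_second_form_time hp, H.fderiv_normal_time_of_touching hp h0 hdim hinj hmin,
    H.inner_fderiv_fderiv hp v (w, 0), real_inner_smul_right, inner_sub_right,
    real_inner_smul_right, real_inner_comm (f p) (fderiv ℝ (fun x => fderiv ℝ f x (v, 0)) p (w, 0))]
  ring

end IsNormalFlow

/-- Elementary consequence of the evolution equations at a touching point, where `c` is the
logarithmic factor `(n + 1) S / r ^ 2` of the gradient of `‖f‖ ^ (n + 1) / lam`. -/
theorem trace_le_of_logarithmic_derivative {n r u S St τ H : ℝ} (hn : 0 ≤ n) (hr : 0 < r)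
    (hu : 0 < u) (hS : 0 < S) (hSt : St ≤ (n + 1) * S / r ^ 2 * (S * u))
    (hτ : τ ≤ -S * H + (n - 1) * ((n + 1) * S / r ^ 2 * u))
    (hlog : St / S + n * (S * u / r / r) + τ =
      (n + 2) * ((S - (n + 1) * S / r ^ 2 * (r ^ 2 - u ^ 2)) / u)) :
    H ≤ n * (n + 2) / u := by
  have h1 : St / S ≤ (n + 1) * S / r ^ 2 * u := by
    rw [div_le_iff₀ hS]; linarith
  have h2 : S * H ≤ (n + 1) * S / r ^ 2 * u + n * (S * u / r / r) +
      (n - 1) * ((n + 1) * S / r ^ 2 * u) -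
      (n + 2) * ((S - (n + 1) * S / r ^ 2 * (r ^ 2 - u ^ 2)) / u) := by linarith
  -- The multiples of Su/r² add up to n(n+1) + n - (n+1)(n+2) = -(n+2); this negative term is
  -- dropped at the end.
  have h3 : (n + 1) * S / r ^ 2 * u + n * (S * u / r / r) +
      (n - 1) * ((n + 1) * S / r ^ 2 * u) -
      (n + 2) * ((S - (n + 1) * S / r ^ 2 * (r ^ 2 - u ^ 2)) / u) =
      S * (n * (n + 2) / u - (n + 2) * u / r ^ 2) := by
    field_simp
    ring
  rw [h3] at h2
  have h4 := le_of_mul_le_mul_left h2 hS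
  have h5 : 0 ≤ (n + 2) * u / r ^ 2 := by positivity
  linarith

/-- Here a = det h and b = det g, with logarithmic time derivatives α and β; dividing `hder` by the
common value in `heq` gives the claim. -/
theorem logarithmic_derivative_eq {S St r rt u ut a b α β : ℝ} {k : ℕ} (hS : S ≠ 0) (hr : r ≠ 0)
    (hu : u ≠ 0) (ha : a ≠ 0) (heq : S * (r ^ (k + 1) * a) = u ^ (k + 3) * b)
    (hder : St * (r ^ (k + 1) * a) + S * ((k + 1 : ℕ) * r ^ k * rt * a + r ^ (k + 1) * (a * α)) =
      (k + 3 : ℕ) * u ^ (k + 2) * ut * b + u ^ (k + 3) * (b * β)) :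
    St / S + (k + 1) * (rt / r) + (α - β) = (k + 3) * (ut / u) := by
  have hV : S * (r ^ (k + 1) * a) ≠ 0 := by positivity
  apply mul_left_cancel₀ hV
  have h1 : S * (r ^ (k + 1) * a) * (St / S + (k + 1) * (rt / r) + (α - β)) =
      St * (r ^ (k + 1) * a) + S * ((k + 1 : ℕ) * r ^ k * rt * a + r ^ (k + 1) * (a * α)) -
        S * (r ^ (k + 1) * a) * β := by
    push_cast
    field_simp
    ring
  rw [h1, hder, heq]
  push_cast
  field_simp
  ring

theorem posSemidef_of_bilinear {F ι : Type*} [NormedAddCommGroup F] [NormedSpace ℝ F] [Fintype ι]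
    (b : ι → F) (D : F →L[ℝ] F →L[ℝ] ℝ) (hsymm : ∀ v w, D v w = D w v) (hD : ∀ v, 0 ≤ D v v) :
    (Matrix.of fun i j => D (b i) (b j)).PosSemidef := by
  refine Matrix.PosSemidef.of_dotProduct_mulVec_nonneg ?_ fun x => ?_
  · ext i j
    exact hsymm _ _
  · have h : x ⬝ᵥ ((Matrix.of fun i j => D (b i) (b j)) *ᵥ x) =
        D (∑ i, x i • b i) (∑ i, x i • b i) := by
      simp only [map_sum, map_smul, _root_.sum_apply, _root_.smul_apply, smul_eq_mul, dotProduct,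
        mulVec, Matrix.of_apply, Finset.mul_sum]
      rw [Finset.sum_comm]
      exact Finset.sum_congr rfl fun i _ => Finset.sum_congr rfl fun j _ => by ring
    rw [star_trivial, h]
    exact hD _

theorem posDef_first_form {F E ι : Type*} [AddCommGroup F] [Module ℝ F] [NormedAddCommGroup E]
    [InnerProductSpace ℝ E] [Fintype ι] (b : Module.Basis ι ℝ F) {P : F →ₗ[ℝ] E}
    (hinj : Function.Injective P) : (pairing b P P).PosDef :=
  posDef_pairing b _ _ (fun _ _ => real_inner_comm _ _) fun _ hv =>
    real_inner_self_pos.2 fun h => hv (hinj (h.trans (map_zero P).symm))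

namespace IsNormalFlow

variable {F E : Type*} [NormedAddCommGroup F] [NormedSpace ℝ F]
  [NormedAddCommGroup E] [InnerProductSpace ℝ E]
  {W : Set (F × ℝ)} {f ν : F × ℝ → E} {S : F × ℝ → ℝ} {p : F × ℝ} {lam : ℝ} {k : ℕ}
  {ι : Type*} [Fintype ι]

theorem posDef_second_form (H : IsNormalFlow W f ν S) (hp : p ∈ W) (b : Module.Basis ι ℝ F)
    (hpos : ∀ v, v ≠ 0 → 0 < ⟪spatialDeriv f p v, spatialDeriv ν p v⟫) :
    (pairing b (spatialDeriv f p) (spatialDeriv ν p)).PosDef :=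
  posDef_pairing b _ _ (H.second_form_symm hp) hpos

/-- The logarithmic derivative of `det h / det g` in time at a touching point. -/
theorem exists_hasDerivAt_det_of_touching [FiniteDimensional ℝ E]
    [FiniteDimensional ℝ F] [DecidableEq ι] (H : IsNormalFlow W f ν S) (hp : p ∈ W)
    (h0 : f p ≠ 0) (hlam : 0 < lam) (b : Module.Basis ι ℝ F)
    (hdim : Module.finrank ℝ E = Module.finrank ℝ F + 1)
    (hinj : Function.Injective (spatialDeriv f p))
    (hpos : ∀ v, v ≠ 0 → 0 < ⟪spatialDeriv f p v, spatialDeriv ν p v⟫)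
    (hmin : IsLocalMin (fun y => S (y, p.2) - ‖f (y, p.2)‖ ^ (k + 2) / lam) p.1) :
    ∃ τh τg : ℝ,
      HasDerivAt (fun s => (pairing b (spatialDeriv f (p.1, s)) (spatialDeriv ν (p.1, s))).det)
        ((pairing b (spatialDeriv f p) (spatialDeriv ν p)).det * τh) p.2 ∧
      HasDerivAt (fun s => (pairing b (spatialDeriv f (p.1, s)) (spatialDeriv f (p.1, s))).det)
        ((pairing b (spatialDeriv f p) (spatialDeriv f p)).det * τg) p.2 ∧
      τh - τg ≤ -S p * ((pairing b (spatialDeriv f p) (spatialDeriv f p))⁻¹ *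
        pairing b (spatialDeriv f p) (spatialDeriv ν p)).trace +
          Fintype.card ι * ((k + 2) / lam * ‖f p‖ ^ k * ⟪f p, ν p⟫) := by
  set P := spatialDeriv f p with hP
  set Q := spatialDeriv ν p with hQ
  have hg := posDef_first_form b hinj
  have hh := H.posDef_second_form hp b hpos
  -- Ψ is a sum of three positive semidefinite matrices: the Hessian of the difference at its
  -- spatial minimum, a rank-one gradient term and a multiple of g.
  let Ψ : Matrix ι ι ℝ := Matrix.of fun i j =>
    fderiv ℝ (fun x => fderiv ℝ (fun x => S x - ‖f x‖ ^ (k + 2) / lam) x (b i, 0)) p (b j, 0) +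
      (k + 2) / lam * (k * ‖f p‖ ^ (k - 1) / ‖f p‖ * (⟪f p, P (b i)⟫ * ⟪f p, P (b j)⟫) +
        ‖f p‖ ^ k * ⟪P (b i), P (b j)⟫)
  have hψ : ContDiffAt ℝ ∞ (fun x => S x - ‖f x‖ ^ (k + 2) / lam) p :=
    (H.contDiffAt_speed p hp).sub (H.contDiffAt_norm_pow_div hp h0)
  have hΨ : Ψ.PosSemidef := by
    have hd : DifferentiableAt ℝ (fderiv ℝ (fun x => S x - ‖f x‖ ^ (k + 2) / lam)) p :=
      (hψ.fderiv_right (m := ∞) (by simp)).differentiableAt (by simp)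
    have hD : ∀ v w : F,
        fderiv ℝ (fun x => fderiv ℝ (fun x => S x - ‖f x‖ ^ (k + 2) / lam) x (v, 0)) p (w, 0) =
        fderiv ℝ (fderiv ℝ (fun x => S x - ‖f x‖ ^ (k + 2) / lam)) p (w, 0) (v, 0) := by
      intro v w
      rw [fderiv_clm_apply hd (differentiableAt_const _)]
      simp
    have h1 := posSemidef_of_bilinear b
      ((fderiv ℝ (fderiv ℝ (fun x => S x - ‖f x‖ ^ (k + 2) / lam)) p).bilinearComp
        (ContinuousLinearMap.inl ℝ F ℝ) (ContinuousLinearMap.inl ℝ F ℝ))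
      (fun v w => by
        simp only [ContinuousLinearMap.bilinearComp_apply, ContinuousLinearMap.inl_apply, ← hD]
        exact fderiv_fderiv_apply_comm hψ _ _)
      (fun v => by
        simp only [ContinuousLinearMap.bilinearComp_apply, ContinuousLinearMap.inl_apply, ← hD]
        exact fderiv_fderiv_nonneg_of_isLocalMin hψ hmin v)
    have h2 := posSemidef_vecMulVec_self_star (fun i => ⟪f p, P (b i)⟫)
    have h3 := (h1.add ((h2.smul (a := (k + 2) / lam * (k * ‖f p‖ ^ (k - 1) / ‖f p‖))
      (by positivity)).add (hg.posSemidef.smul (a := (k + 2) / lam * ‖f p‖ ^ k)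
        (by positivity))))
    convert h3 using 1
    ext i j
    simp only [Ψ, Matrix.of_apply, Matrix.add_apply, Matrix.smul_apply, vecMulVec_apply,
      smul_eq_mul, star_trivial, pairing, ContinuousLinearMap.bilinearComp_apply,
      ContinuousLinearMap.inl_apply, ← hD]
    rw [fderiv_fderiv_apply_comm hψ]
    ring
  have hνrange : ∀ v, Q v ∈ LinearMap.range P := fun v =>
    mem_range_of_inner_eq_zero hdim hinj
      (norm_ne_zero_iff.1 (by rw [H.norm_normal p hp]; exact one_ne_zero))
      (H.inner_normal p hp) (H.inner_fderiv_normal hp (v, 0))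
  have hC := pairing_self_eq b P Q (H.second_form_symm hp) hνrange hg.det_pos.ne'
  refine ⟨_, _, hasDerivAt_det (A' := S p • pairing b Q Q - Ψ +
      ((k + 2) / lam * ‖f p‖ ^ k * ⟪f p, ν p⟫) • pairing b P Q) (fun i j => ?_) hh.det_pos.ne',
    hasDerivAt_det (A' := (2 * S p) • pairing b P Q) (fun i j => ?_) hg.det_pos.ne', ?_⟩
  · have hd : DifferentiableAt ℝ (fun x => ⟪fderiv ℝ f x (b i, 0), fderiv ℝ ν x (b j, 0)⟫) p :=
      (H.differentiableAt_fderiv_map hp _).inner ℝ (H.differentiableAt_fderiv_normal hp _)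
    have h := hasDerivAt_prodMk_right hd
    rw [H.fderiv_second_form_of_touching hp h0 hdim hinj hmin] at h
    exact h
  · have hd : DifferentiableAt ℝ (fun x => ⟪fderiv ℝ f x (b i, 0), fderiv ℝ f x (b j, 0)⟫) p :=
      (H.differentiableAt_fderiv_map hp _).inner ℝ (H.differentiableAt_fderiv_map hp _)
    have h := hasDerivAt_prodMk_right hd
    rw [H.fderiv_first_form_time hp] at h
    exact h
  · exact trace_sub_trace_le hh hΨ hC _ _

/-- The bound on the mean curvature at a point where the speed of the dual flow touches
`‖f‖ ^ (k + 2) / lam` from above. -/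
theorem trace_le_of_touching [FiniteDimensional ℝ E]
    [FiniteDimensional ℝ F] [DecidableEq ι] (H : IsNormalFlow W f ν S) (hp : p ∈ W)
    (h0 : f p ≠ 0) (hlam : 0 < lam) (b : Module.Basis ι ℝ F) (hcard : Fintype.card ι = k)
    (hdim : Module.finrank ℝ E = Module.finrank ℝ F + 1)
    (hinj : Function.Injective (spatialDeriv f p))
    (hpos : ∀ v, v ≠ 0 → 0 < ⟪spatialDeriv f p v, spatialDeriv ν p v⟫)
    (hu : 0 < ⟪f p, ν p⟫)
    (hspeed : ∀ x ∈ W, S x * (‖f x‖ ^ (k + 1) *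
      (pairing b (spatialDeriv f x) (spatialDeriv ν x)).det) =
        ⟪f x, ν x⟫ ^ (k + 3) * (pairing b (spatialDeriv f x) (spatialDeriv f x)).det)
    (heq : S p = ‖f p‖ ^ (k + 2) / lam)
    (hmin : ∀ᶠ x in 𝓝 p, x.2 ≤ p.2 → ‖f x‖ ^ (k + 2) / lam ≤ S x) :
    ((pairing b (spatialDeriv f p) (spatialDeriv f p))⁻¹ *
        pairing b (spatialDeriv f p) (spatialDeriv ν p)).trace ≤
      (k + 1) * (k + 3) / ⟪f p, ν p⟫ := by
  have hr : 0 < ‖f p‖ := norm_pos_iff.2 h0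
  have hSp : 0 < S p := by rw [heq]; positivity
  -- The touching condition eliminates λ from all evolution equations.
  have hcoef : (k + 2) / lam * ‖f p‖ ^ k = (k + 2) * S p / ‖f p‖ ^ 2 := by
    rw [heq, pow_add]; field_simp
  have hspace : IsLocalMin (fun y => S (y, p.2) - ‖f (y, p.2)‖ ^ (k + 2) / lam) p.1 := by
    have ht : Tendsto (fun y : F => (y, p.2)) (𝓝 p.1) (𝓝 p) :=
      (Continuous.prodMk_left p.2).tendsto p.1
    filter_upwards [ht.eventually hmin] with y hy
    have := hy le_rfl
    simp only [heq, sub_self]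
    linarith
  have htime : ∀ᶠ s in 𝓝 p.2, s ≤ p.2 → S (p.1, p.2) - ‖f (p.1, p.2)‖ ^ (k + 2) / lam ≤
      S (p.1, s) - ‖f (p.1, s)‖ ^ (k + 2) / lam := by
    have ht : Tendsto (fun s : ℝ => (p.1, s)) (𝓝 p.2) (𝓝 p) :=
      (Continuous.prodMk_right p.1).tendsto p.2
    filter_upwards [ht.eventually hmin] with s hs hle
    have := hs hle
    simp only [Prod.mk.eta, heq, sub_self]
    linarith
  have hdS := H.differentiableAt_speed hp
  have hdf := H.differentiableAt_map hp
  have hda : DifferentiableAt ℝ (fun x => ‖f x‖ ^ (k + 2) / lam) p :=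
    (H.contDiffAt_norm_pow_div hp h0).differentiableAt (by simp)
  have hfft : ⟪f p, fderiv ℝ f p (0, 1)⟫ = S p * ⟪f p, ν p⟫ := by
    rw [H.flow p hp, real_inner_smul_right]
  have hSt : fderiv ℝ S p (0, 1) ≤ (k + 2) * S p / ‖f p‖ ^ 2 * (S p * ⟪f p, ν p⟫) := by
    have h := nonpos_of_hasDerivAt_of_min_left
      ((hasDerivAt_prodMk_right hdS).sub (hasDerivAt_prodMk_right hda)) htime
    rw [fderiv_norm_pow_add_two_div_apply hdf h0, hfft, ← mul_assoc, hcoef] at h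
    linarith
  obtain ⟨τh, τg, hτh, hτg, hτ⟩ :=
    H.exists_hasDerivAt_det_of_touching hp h0 hlam b hdim hinj hpos hspace
  rw [hcoef, hcard] at hτ
  have hdetg : 0 < (pairing b (spatialDeriv f p) (spatialDeriv f p)).det :=
    (posDef_first_form b hinj).det_pos
  have hdeth : 0 < (pairing b (spatialDeriv f p) (spatialDeriv ν p)).det :=
    (H.posDef_second_form hp b hpos).det_pos
  have hrt : HasDerivAt (fun s => ‖f (p.1, s)‖) (S p * ⟪f p, ν p⟫ / ‖f p‖) p.2 := by
    have h := hasDerivAt_prodMk_right (hdf.norm ℝ h0)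
    rwa [fderiv_norm_apply hdf h0, hfft] at h
  have hut : HasDerivAt (fun s => ⟪f (p.1, s), ν (p.1, s)⟫)
      (S p - (k + 2) * S p / ‖f p‖ ^ 2 * (‖f p‖ ^ 2 - ⟪f p, ν p⟫ ^ 2)) p.2 := by
    have h := hasDerivAt_prodMk_right (hdf.inner ℝ (H.differentiableAt_normal hp))
    rw [fderiv_inner_apply ℝ hdf (H.differentiableAt_normal hp), H.flow p hp,
      H.fderiv_normal_time_of_touching hp h0 hdim hinj hspace, hcoef, real_inner_smul_left,
      real_inner_self_eq_norm_sq (ν p), H.norm_normal p hp, real_inner_smul_right,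
      inner_sub_right, real_inner_smul_right, real_inner_self_eq_norm_sq] at h
    exact h.congr_deriv (by ring)
  -- The speed identity holds for all times near `p.2`, so the time derivatives of its two sides
  -- agree.
  have hL := (hasDerivAt_prodMk_right hdS).mul ((hrt.pow (k + 1)).mul hτh)
  have hR := (hut.pow (k + 3)).mul hτg
  have hEq := hspeed p hp
  have hev : ∀ᶠ s in 𝓝 p.2, (p.1, s) ∈ W := by
    have ht : Tendsto (fun s : ℝ => (p.1, s)) (𝓝 p.2) (𝓝 p) :=
      (Continuous.prodMk_right p.1).tendsto p.2
    exact ht.eventually (H.isOpen.mem_nhds hp)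
  have hder := (hL.congr_of_eventuallyEq (f₁ := fun s => ⟪f (p.1, s), ν (p.1, s)⟫ ^ (k + 3) *
      (pairing b (spatialDeriv f (p.1, s)) (spatialDeriv f (p.1, s))).det)
      (by filter_upwards [hev] with s hs using (hspeed _ hs).symm)).unique hR
  refine trace_le_of_logarithmic_derivative (n := (k : ℝ) + 1) (τ := τh - τg) (S := S p)
    (St := fderiv ℝ S p (0, 1)) (r := ‖f p‖) (by positivity) hr hu hSp ?_ ?_ ?_ |>.trans_eq ?_
  · convert hSt using 2; ring
  · convert hτ using 2; ring
  · simp only [Prod.mk.eta, Pi.pow_apply, Pi.mul_apply] at hder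
    have h := logarithmic_derivative_eq hSp.ne' hr.ne' hu.ne' hdeth.ne' hEq hder
    convert h using 2 <;> ring
  · ring

end IsNormalFlow

/-! ### Smoothness on U × [0, T), including the initial time. -/

section Slab

theorem slab_mem_nhds {F : Type*} [TopologicalSpace F] {U : Set F} {T : ℝ} (hU : IsOpen U) {p : F × ℝ}
    (hp : p ∈ U ×ˢ Ioo 0 T) :
    U ×ˢ Ico 0 T ∈ 𝓝 p :=
  mem_of_superset ((hU.prod isOpen_Ioo).mem_nhds hp) (prod_mono_right Ioo_subset_Ico_self)

variable {F E : Type*} [NormedAddCommGroup F] [NormedSpace ℝ F]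
  [NormedAddCommGroup E] [InnerProductSpace ℝ E] {U : Set F} {T : ℝ}

theorem uniqueDiffOn_slab (hU : IsOpen U) : UniqueDiffOn ℝ (U ×ˢ Ico 0 T) :=
  hU.uniqueDiffOn.prod (uniqueDiffOn_Ico 0 T)

/-- The derivative in the first variable of a map on `U × [0, T)`, one-sided in time. -/
noncomputable def slabDeriv (U : Set F) (T : ℝ) (f : F × ℝ → E) (p : F × ℝ) : F →L[ℝ] E :=
  (fderivWithin ℝ f (U ×ˢ Ico 0 T) p).comp (ContinuousLinearMap.inl ℝ F ℝ)

theorem contDiffOn_slabDeriv (hU : IsOpen U) {f : F × ℝ → E}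
    (hf : ContDiffOn ℝ ∞ f (U ×ˢ Ico 0 T)) :
    ContDiffOn ℝ ∞ (slabDeriv U T f) (U ×ˢ Ico 0 T) :=
  (hf.fderivWithin (uniqueDiffOn_slab hU) (m := ∞) (by simp)).clm_comp contDiffOn_const

theorem hasFDerivAt_slabDeriv (hU : IsOpen U) {f : F × ℝ → E}
    (hf : ContDiffOn ℝ ∞ f (U ×ˢ Ico 0 T)) {z : F} {t : ℝ} (hz : z ∈ U) (ht : t ∈ Ico 0 T) :
    HasFDerivAt (fun y => f (y, t)) (slabDeriv U T f (z, t)) z := by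
  have h1 : HasFDerivWithinAt f (fderivWithin ℝ f (U ×ˢ Ico 0 T) (z, t)) (U ×ˢ Ico 0 T) (z, t) :=
    (hf.differentiableOn (by simp) (z, t) ⟨hz, ht⟩).hasFDerivWithinAt
  have h2 : HasFDerivWithinAt (fun y : F => (y, t)) (ContinuousLinearMap.inl ℝ F ℝ) U z :=
    (hasFDerivAt_prodMk_left z t).hasFDerivWithinAt
  have h3 : MapsTo (fun y : F => (y, t)) U (U ×ˢ Ico 0 T) := fun y hy => ⟨hy, ht⟩
  exact (HasFDerivWithinAt.comp z h1 h2 h3).hasFDerivAt (hU.mem_nhds hz)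

theorem slabDeriv_eq_spatialDeriv (hU : IsOpen U) (f : F × ℝ → E) {p : F × ℝ}
    (hp : p ∈ U ×ˢ Ioo 0 T) : (slabDeriv U T f p : F →ₗ[ℝ] E) = spatialDeriv f p := by
  ext v
  simp only [slabDeriv, fderivWithin_of_mem_nhds (slab_mem_nhds hU hp)]
  rfl

/-- The unit normal of a smooth family of star-shaped hypersurfaces is smooth. -/
theorem contDiffOn_normal {X : Type*} [NormedAddCommGroup X] [NormedSpace ℝ X]
    [FiniteDimensional ℝ E] [FiniteDimensional ℝ F]
    (hdim : Module.finrank ℝ E = Module.finrank ℝ F + 1) {Ω : Set X} {f ν : X → E}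
    {P : X → F →L[ℝ] E} (hf : ContDiffOn ℝ ∞ f Ω) (hP : ContDiffOn ℝ ∞ P Ω)
    (hinj : ∀ p ∈ Ω, Function.Injective (P p)) (hperp : ∀ p ∈ Ω, ∀ v, ⟪P p v, ν p⟫ = 0)
    (hν : ∀ p ∈ Ω, ‖ν p‖ = 1) (hu : ∀ p ∈ Ω, 0 < ⟪f p, ν p⟫) : ContDiffOn ℝ ∞ ν Ω := by
  -- Since ⟪f, ν⟫ > 0, the position vector f is transverse to the tangent space, so B p is an
  -- isomorphism.
  let B : X → F × ℝ →L[ℝ] E := fun p =>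
    (P p).comp (ContinuousLinearMap.fst ℝ F ℝ) +
      (ContinuousLinearMap.snd ℝ F ℝ).smulRight (f p)
  have hB : ContDiffOn ℝ ∞ B Ω :=
    (hP.clm_comp contDiffOn_const).add (contDiffOn_const.smulRight hf)
  have hBν : ∀ p ∈ Ω, ∀ x, ⟪ν p, B p x⟫ = x.2 * ⟪f p, ν p⟫ := fun p hp x => by
    rw [real_inner_comm]
    simp [B, inner_add_left, real_inner_smul_left, hperp p hp]
  have hBinj : ∀ p ∈ Ω, Function.Injective (B p) := fun p hp => by
    refine (injective_iff_map_eq_zero (B p)).2 fun x hx => ?_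
    have h1 := hBν p hp x
    rw [hx, inner_zero_right, eq_comm, mul_eq_zero, or_iff_left (hu p hp).ne'] at h1
    have h2 : P p x.1 = 0 := by simpa [B, h1] using hx
    exact Prod.ext (hinj p hp (h2.trans (map_zero _).symm)) h1
  have hfin : Module.finrank ℝ (F × ℝ) = Module.finrank ℝ E := by
    rw [Module.finrank_prod, Module.finrank_self, hdim]
  -- The functional y ↦ (B p)⁻¹ y, second coordinate, is represented by ν / ⟪f, ν⟫. It is smooth
  -- because inversion is, and normalizing it recovers ν.
  let w : X → E := fun p => (InnerProductSpace.toDual ℝ E).symm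
    ((ContinuousLinearMap.snd ℝ F ℝ).comp (B p).inverse)
  have hinv : ∀ p ∈ Ω, ∃ e : (F × ℝ) ≃L[ℝ] E, (e : F × ℝ →L[ℝ] E) = B p := fun p hp =>
    ⟨(LinearEquiv.ofInjectiveOfFinrankEq (B p : F × ℝ →ₗ[ℝ] E) (hBinj p hp)
      hfin).toContinuousLinearEquiv, by ext <;> rfl⟩
  have hw : ContDiffOn ℝ ∞ w Ω := by
    intro p hp
    obtain ⟨e, he⟩ := hinv p hp
    have h1 : ContDiffWithinAt ℝ ∞ (fun q => (B q).inverse) Ω p := by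
      have h := contDiffAt_map_inverse (𝕜 := ℝ) (n := ∞) e
      rw [he] at h
      exact h.comp_contDiffWithinAt p (hB p hp)
    exact (InnerProductSpace.toDual ℝ E).symm.contDiff.contDiffAt.comp_contDiffWithinAt p
      (contDiffWithinAt_const.clm_comp h1)
  have hwν : ∀ p ∈ Ω, w p = ⟪f p, ν p⟫⁻¹ • ν p := fun p hp => by
    obtain ⟨e, he⟩ := hinv p hp
    refine ext_inner_right ℝ fun y => ?_
    have h1 := hBν p hp (e.symm y)
    have h2 : B p (e.symm y) = y := by rw [← he]; exact e.apply_symm_apply y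
    rw [h2] at h1
    rw [InnerProductSpace.toDual_symm_apply, real_inner_smul_left, h1, ← he,
      ContinuousLinearMap.inverse_equiv]
    have h3 := (hu p hp).ne'
    simp only [ContinuousLinearMap.comp_apply, ContinuousLinearMap.coe_snd',
      ContinuousLinearEquiv.coe_coe]
    field_simp
  have hwnorm : ∀ p ∈ Ω, ‖w p‖ = ⟪f p, ν p⟫⁻¹ := fun p hp => by
    rw [hwν p hp, norm_smul, hν p hp, mul_one, Real.norm_of_nonneg (inv_nonneg.2 (hu p hp).le)]
  have hw0 : ∀ p ∈ Ω, w p ≠ 0 := fun p hp => by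
    rw [← norm_ne_zero_iff, hwnorm p hp]
    exact (inv_pos.2 (hu p hp)).ne'
  have hnorm : ContDiffOn ℝ ∞ (fun p => ‖w p‖) Ω := hw.norm ℝ hw0
  refine ((hnorm.inv fun p hp => norm_ne_zero_iff.2 (hw0 p hp)).smul hw).congr fun p hp => ?_
  rw [Pi.smul_apply', Pi.inv_apply, hwnorm p hp, inv_inv, hwν p hp, smul_smul, mul_inv_cancel₀ (hu p hp).ne', one_smul]

theorem contDiffOn_det_pairing {X ι : Type*} [NormedAddCommGroup X] [NormedSpace ℝ X] [Fintype ι]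
    [DecidableEq ι] {Ω : Set X} (b : ι → F) {P Q : X → F →L[ℝ] E} (hP : ContDiffOn ℝ ∞ P Ω)
    (hQ : ContDiffOn ℝ ∞ Q Ω) :
    ContDiffOn ℝ ∞ (fun p => (pairing b (P p) (Q p)).det) Ω := by
  simp only [Matrix.det_apply]
  refine ContDiffOn.sum fun σ _ => ContDiffOn.const_smul _ (contDiffOn_prod fun i _ => ?_)
  exact (hP.clm_apply contDiffOn_const).inner ℝ (hQ.clm_apply contDiffOn_const)

end Slab

/-! ### Passage from the manifold to coordinates. -/

section Charts

variable {n : ℕ} {M : Type*} [TopologicalSpace M]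
  [ChartedSpace (EuclideanSpace ℝ (Fin (n - 1))) M]

/-- The standard basis of the model space. -/
noncomputable def stdBasis (n : ℕ) :
    Module.Basis (Fin (n - 1)) ℝ (EuclideanSpace ℝ (Fin (n - 1))) :=
  (EuclideanSpace.basisFun (Fin (n - 1)) ℝ).toBasis

theorem stdBasis_apply (i : Fin (n - 1)) : stdBasis n i = EuclideanSpace.single i (1 : ℝ) := by
  simp [stdBasis]

/-- A time dependent map in the preferred coordinates around `x₀`. -/
noncomputable def inChart (x₀ : M) (φ : M → ℝ → EuclideanSpace ℝ (Fin n))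
    (p : EuclideanSpace ℝ (Fin (n - 1)) × ℝ) : EuclideanSpace ℝ (Fin n) :=
  φ ((extChartAt (𝓡 (n - 1)) x₀).symm p.1) p.2

theorem inChart_apply (x₀ : M) (φ : M → ℝ → EuclideanSpace ℝ (Fin n)) {x : M}
    (hx : x ∈ (extChartAt (𝓡 (n - 1)) x₀).source) (t : ℝ) :
    inChart x₀ φ (extChartAt (𝓡 (n - 1)) x₀ x, t) = φ x t := by
  simp only [inChart, (extChartAt (𝓡 (n - 1)) x₀).left_inv hx]

theorem contDiffOn_inChart [IsManifold (𝓡 (n - 1)) ∞ M] {T : ℝ}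
    {φ : M → ℝ → EuclideanSpace ℝ (Fin n)}
    (hφ : ContMDiffOn ((𝓡 (n - 1)).prod 𝓘(ℝ, ℝ)) 𝓘(ℝ, EuclideanSpace ℝ (Fin n)) ∞
      (fun p : M × ℝ => φ p.1 p.2) (univ ×ˢ Ico 0 T)) (x₀ : M) :
    ContDiffOn ℝ ∞ (inChart x₀ φ) ((extChartAt (𝓡 (n - 1)) x₀).target ×ˢ Ico 0 T) := by
  have h1 : ContMDiffOn (𝓘(ℝ, EuclideanSpace ℝ (Fin (n - 1))).prod 𝓘(ℝ, ℝ))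
      ((𝓡 (n - 1)).prod 𝓘(ℝ, ℝ)) ∞
      (Prod.map (extChartAt (𝓡 (n - 1)) x₀).symm (id : ℝ → ℝ))
      ((extChartAt (𝓡 (n - 1)) x₀).target ×ˢ Ico 0 T) :=
    (contMDiffOn_extChartAt_symm x₀).prodMap contMDiffOn_id
  have h2 := hφ.comp h1 fun p hp => ⟨mem_univ _, hp.2⟩
  rw [← modelWithCornersSelf_prod, chartedSpaceSelf_prod, contMDiffOn_iff_contDiffOn] at h2
  exact h2

/-- The chain rule for the passage to coordinates around `x₀`. -/
theorem diff_eq_of_hasFDerivAt [IsManifold (𝓡 (n - 1)) ∞ M] {x₀ x : M}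
    (hx : x ∈ (extChartAt (𝓡 (n - 1)) x₀).source) {g : M → EuclideanSpace ℝ (Fin n)}
    {g' : EuclideanSpace ℝ (Fin (n - 1)) →L[ℝ] EuclideanSpace ℝ (Fin n)}
    (hg : HasFDerivAt (fun z => g ((extChartAt (𝓡 (n - 1)) x₀).symm z)) g'
      (extChartAt (𝓡 (n - 1)) x₀ x)) (v : TangentSpace (𝓡 (n - 1)) x) :
    diff g x v = g' (mfderiv (𝓡 (n - 1)) 𝓘(ℝ, EuclideanSpace ℝ (Fin (n - 1)))
      (extChartAt (𝓡 (n - 1)) x₀) x v) := by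
  have : IsManifold (𝓡 (n - 1)) 1 M := IsManifold.of_le (n := ∞) (by simp)
  have hx' : x ∈ (chartAt (EuclideanSpace ℝ (Fin (n - 1))) x₀).source := by
    rwa [extChartAt_source] at hx
  have h1 := hg.hasMFDerivAt.comp x (mdifferentiableAt_extChartAt hx').hasMFDerivAt
  have h2 : g =ᶠ[𝓝 x] (fun z => g ((extChartAt (𝓡 (n - 1)) x₀).symm z)) ∘
      extChartAt (𝓡 (n - 1)) x₀ := by
    filter_upwards [extChartAt_source_mem_nhds' hx] with y hy
    simp only [Function.comp_apply, (extChartAt (𝓡 (n - 1)) x₀).left_inv hy]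
  have h3 := (h1.congr_of_eventuallyEq h2).mfderiv
  rw [diff, h3]
  rfl

theorem bijective_mfderiv_extChartAt [IsManifold (𝓡 (n - 1)) ∞ M] {x₀ x : M}
    (hx : x ∈ (extChartAt (𝓡 (n - 1)) x₀).source) :
    Function.Bijective (mfderiv (𝓡 (n - 1)) 𝓘(ℝ, EuclideanSpace ℝ (Fin (n - 1)))
      (extChartAt (𝓡 (n - 1)) x₀) x) := by
  have : IsManifold (𝓡 (n - 1)) 1 M := IsManifold.of_le (n := ∞) (by simp)
  exact (isInvertible_mfderiv_extChartAt hx).bijective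

/-- `gaussCurvature` uses the preferred coordinates at x itself, whereas smoothness needs one fixed
chart. The transition A multiplies both determinants by (det A)². -/
theorem gaussCurvature_eq_of_comp {f ν : M → EuclideanSpace ℝ (Fin n)} {x : M}
    {P Q : EuclideanSpace ℝ (Fin (n - 1)) →ₗ[ℝ] EuclideanSpace ℝ (Fin n)}
    {A : EuclideanSpace ℝ (Fin (n - 1)) →ₗ[ℝ] EuclideanSpace ℝ (Fin (n - 1))}
    (hA : Function.Bijective A) (hP : ∀ v, diff f x v = P (A v))
    (hQ : ∀ v, diff ν x v = Q (A v)) :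
    gaussCurvature f ν x =
      (pairing (stdBasis n) P Q).det / (pairing (stdBasis n) P P).det := by
  rw [← det_pairing_comp_div (stdBasis n) P Q A hA, gaussCurvature]
  congr 2
  · ext i j
    simp only [secondForm, pairing, Matrix.of_apply, LinearMap.comp_apply, stdBasis_apply]
    exact congrArg₂ _ (hP _) (hQ _)
  · ext i j
    simp only [firstForm, pairing, Matrix.of_apply, LinearMap.comp_apply, stdBasis_apply]
    exact congrArg₂ _ (hP _) (hP _)

end Charts

/-! ### Consequences of the supporting half-spaces. -/

namespace IsStrictlyConvexBoundary

variable {n : ℕ} {M : Type*} [TopologicalSpace M]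
  [ChartedSpace (EuclideanSpace ℝ (Fin (n - 1))) M] {f ν : M → EuclideanSpace ℝ (Fin n)}

theorem norm_normal (h : IsStrictlyConvexBoundary f ν) (x : M) : ‖ν x‖ = 1 := by
  obtain ⟨K, -, -, hK⟩ := h.body
  exact (hK x).1

theorem inner_le (h : IsStrictlyConvexBoundary f ν) (x y : M) : ⟪f y, ν x⟫ ≤ ⟪f x, ν x⟫ := by
  obtain ⟨K, -, hr, hK⟩ := h.body
  have hy : f y ∈ K := by
    have h1 : f y ∈ frontier (K : Set (EuclideanSpace ℝ (Fin n))) := hr ▸ mem_range_self y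
    exact K.isClosed.frontier_subset h1
  have h2 := (hK x).2 (f y) hy
  rw [inner_sub_left] at h2
  linarith

/-- A small positive multiple of ν x lies in the body, the origin being interior, and obeys the
half-space inequality at f x. -/
theorem support_pos (h : IsStrictlyConvexBoundary f ν) (x : M) : 0 < ⟪f x, ν x⟫ := by
  obtain ⟨K, h0, -, hK⟩ := h.body
  obtain ⟨ε, hε, hball⟩ := Metric.isOpen_iff.1 isOpen_interior 0 h0
  have hmem : (ε / 2) • ν x ∈ K := by
    refine interior_subset (hball ?_)
    rw [mem_ball_zero_iff, norm_smul, h.norm_normal, Real.norm_of_nonneg (by positivity)]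
    linarith
  have h2 := (hK x).2 _ hmem
  rw [inner_sub_left, real_inner_smul_left, real_inner_self_eq_norm_sq, h.norm_normal] at h2
  linarith

theorem ne_zero (h : IsStrictlyConvexBoundary f ν) (x : M) : f x ≠ 0 := fun h0 => by
  have := h.support_pos x
  simp [h0] at this

end IsStrictlyConvexBoundary

/-- The threshold has room to spare: n(n+2) < 2n² + 5n + 2, and its total power of γ, namely 4n + 8
+ (2n+4)(n-1), exceeds 2n + 1 while γ ≤ 1. -/
theorem pow_lt_mul_of_threshold_le {n : ℕ} (hn : 2 ≤ n) {γ lam : ℝ} (hγ0 : 0 < γ) (hγ1 : γ ≤ 1)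
    (hlam : threshold n γ ≤ lam) :
    ((n : ℝ) * (n + 2)) ^ (n - 1) < ((n : ℝ) - 1) ^ (n - 1) * γ ^ (2 * n + 1) * lam := by
  have hn' : (2 : ℝ) ≤ n := by exact_mod_cast hn
  have hn1 : (0 : ℝ) < (n : ℝ) - 1 := by linarith
  set e : ℝ := (4 * (n : ℝ) + 8) / ((n : ℝ) - 1) + 2 * n + 4 with he
  have hγe : 0 < γ ^ e := Real.rpow_pos_of_pos hγ0 e
  have h1 : (γ ^ e) ^ (n - 1) ≤ γ ^ (2 * n + 1) := by
    rw [← Real.rpow_natCast, ← Real.rpow_mul hγ0.le, ← Real.rpow_natCast γ (2 * n + 1)]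
    apply Real.rpow_le_rpow_of_exponent_ge hγ0 hγ1
    rw [Nat.cast_sub (by omega)]
    push_cast
    have h2 : e * ((n : ℝ) - 1) = 4 * n + 8 + (2 * n + 4) * (n - 1) := by
      rw [he]; field_simp; ring
    rw [h2]
    nlinarith
  have h3 : threshold n γ * (((n : ℝ) - 1) ^ (n - 1) * (γ ^ e) ^ (n - 1)) =
      (2 * (n : ℝ) ^ 2 + 5 * n + 2) ^ (n - 1) := by
    rw [threshold, ← he, ← mul_pow, ← mul_pow, div_mul_cancel₀ _ (by positivity)]
  have hlam0 : 0 ≤ threshold n γ := by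
    rw [threshold, ← he]; positivity
  calc ((n : ℝ) * (n + 2)) ^ (n - 1) < (2 * (n : ℝ) ^ 2 + 5 * n + 2) ^ (n - 1) :=
        pow_lt_pow_left₀ (by nlinarith) (by positivity) (by omega)
    _ = threshold n γ * (((n : ℝ) - 1) ^ (n - 1) * (γ ^ e) ^ (n - 1)) := h3.symm
    _ ≤ lam * (((n : ℝ) - 1) ^ (n - 1) * γ ^ (2 * n + 1)) := by
        gcongr
        exact hlam0.trans hlam
    _ = _ := by ring

theorem threshold_pos {n : ℕ} (hn : 2 ≤ n) {γ : ℝ} (hγ0 : 0 < γ) : 0 < threshold n γ := by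
  have hn' : (2 : ℝ) ≤ n := by exact_mod_cast hn
  have hn1 : (0 : ℝ) < (n : ℝ) - 1 := by linarith
  have := Real.rpow_pos_of_pos hγ0 ((4 * (n : ℝ) + 8) / ((n : ℝ) - 1) + 2 * n + 4)
  rw [threshold]
  positivity

/-! ### Geometry of the dual flow in a chart. -/

namespace IsDualFlow

variable {n : ℕ} {M : Type*} [TopologicalSpace M]
  [ChartedSpace (EuclideanSpace ℝ (Fin (n - 1))) M] [IsManifold (𝓡 (n - 1)) ∞ M]
  {T : ℝ} {φ ν : M → ℝ → EuclideanSpace ℝ (Fin n)}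

local notation "𝕌" x₀ => PartialEquiv.target (extChartAt (𝓡 (n - 1)) x₀)

theorem contDiffOn_map (H : IsDualFlow T φ ν) (x₀ : M) :
    ContDiffOn ℝ ∞ (inChart x₀ φ) ((𝕌 x₀) ×ˢ Ico 0 T) :=
  contDiffOn_inChart H.smooth x₀

/-- Normality is given only through supporting hyperplanes; orthogonality follows since ⟪φ(y), ν(x)⟫
is maximal at y = x. -/
theorem inner_slabDeriv_normal (H : IsDualFlow T φ ν) (x₀ : M)
    {p : EuclideanSpace ℝ (Fin (n - 1)) × ℝ} (hp : p ∈ (𝕌 x₀) ×ˢ Ico 0 T)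
    (v : EuclideanSpace ℝ (Fin (n - 1))) :
    ⟪slabDeriv (𝕌 x₀) T (inChart x₀ φ) p v, inChart x₀ ν p⟫ = 0 := by
  have hd := hasFDerivAt_slabDeriv (isOpen_extChartAt_target x₀) (H.contDiffOn_map x₀) hp.1 hp.2
  have h1 := (innerSL ℝ (inChart x₀ ν p)).hasFDerivAt.comp p.1 hd
  have hmax : IsLocalMax (innerSL ℝ (inChart x₀ ν p) ∘ fun y => inChart x₀ φ (y, p.2)) p.1 := by
    refine Filter.Eventually.of_forall fun y => ?_
    simp only [Function.comp_apply, innerSL_apply_apply, real_inner_comm _ (inChart x₀ ν p)]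
    exact (H.convex p.2 hp.2).inner_le _ _
  have h2 := congrArg (fun L => L v) (hmax.hasFDerivAt_eq_zero h1)
  rw [real_inner_comm]
  exact h2

theorem injective_slabDeriv (H : IsDualFlow T φ ν) (x₀ : M)
    {p : EuclideanSpace ℝ (Fin (n - 1)) × ℝ} (hp : p ∈ (𝕌 x₀) ×ˢ Ico 0 T) :
    Function.Injective (slabDeriv (𝕌 x₀) T (inChart x₀ φ) p) := by
  have hd := hasFDerivAt_slabDeriv (isOpen_extChartAt_target x₀) (H.contDiffOn_map x₀) hp.1 hp.2
  set x := (extChartAt (𝓡 (n - 1)) x₀).symm p.1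
  have hx : x ∈ (extChartAt (𝓡 (n - 1)) x₀).source := (extChartAt (𝓡 (n - 1)) x₀).map_target hp.1
  have hxp : extChartAt (𝓡 (n - 1)) x₀ x = p.1 := (extChartAt (𝓡 (n - 1)) x₀).right_inv hp.1
  have h1 := diff_eq_of_hasFDerivAt hx (g := fun y => φ y p.2) (by rw [hxp]; exact hd)
  have hA := bijective_mfderiv_extChartAt hx
  refine (injective_iff_map_eq_zero _).2 fun w hw => ?_
  obtain ⟨v, rfl⟩ := hA.2 w
  have h2 : diff (fun y => φ y p.2) x v = 0 := (h1 v).trans hw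
  have h3 : v = 0 := (H.convex p.2 hp.2).immersion x (h2.trans (map_zero _).symm)
  rw [h3]
  exact map_zero _

theorem finrank_eq (hn : 2 ≤ n) : Module.finrank ℝ (EuclideanSpace ℝ (Fin n)) =
    Module.finrank ℝ (EuclideanSpace ℝ (Fin (n - 1))) + 1 := by
  rw [finrank_euclideanSpace_fin, finrank_euclideanSpace_fin]
  omega

/-- `IsDualFlow` asks for joint smoothness of φ only; that of ν is a consequence. -/
theorem contDiffOn_normal (H : IsDualFlow T φ ν) (hn : 2 ≤ n) (x₀ : M) :
    ContDiffOn ℝ ∞ (inChart x₀ ν) ((𝕌 x₀) ×ˢ Ico 0 T) :=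
  DualFlow.contDiffOn_normal (finrank_eq hn) (H.contDiffOn_map x₀)
    (contDiffOn_slabDeriv (isOpen_extChartAt_target x₀) (H.contDiffOn_map x₀))
    (fun _ hp => H.injective_slabDeriv x₀ hp) (fun _ hp => H.inner_slabDeriv_normal x₀ hp)
    (fun p hp => (H.convex p.2 hp.2).norm_normal _) fun p hp => (H.convex p.2 hp.2).support_pos _

theorem second_form_pos (H : IsDualFlow T φ ν) (hn : 2 ≤ n) (x₀ : M)
    {p : EuclideanSpace ℝ (Fin (n - 1)) × ℝ} (hp : p ∈ (𝕌 x₀) ×ˢ Ico 0 T)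
    {w : EuclideanSpace ℝ (Fin (n - 1))} (hw : w ≠ 0) :
    0 < ⟪slabDeriv (𝕌 x₀) T (inChart x₀ φ) p w, slabDeriv (𝕌 x₀) T (inChart x₀ ν) p w⟫ := by
  have hU := isOpen_extChartAt_target (I := 𝓡 (n - 1)) x₀
  have hd := hasFDerivAt_slabDeriv hU (H.contDiffOn_map x₀) hp.1 hp.2
  have hd' := hasFDerivAt_slabDeriv hU (H.contDiffOn_normal hn x₀) hp.1 hp.2
  set x := (extChartAt (𝓡 (n - 1)) x₀).symm p.1
  have hx : x ∈ (extChartAt (𝓡 (n - 1)) x₀).source := (extChartAt (𝓡 (n - 1)) x₀).map_target hp.1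
  have hxp : extChartAt (𝓡 (n - 1)) x₀ x = p.1 := (extChartAt (𝓡 (n - 1)) x₀).right_inv hp.1
  have h1 := diff_eq_of_hasFDerivAt hx (g := fun y => φ y p.2) (by rw [hxp]; exact hd)
  have h2 := diff_eq_of_hasFDerivAt hx (g := fun y => ν y p.2) (by rw [hxp]; exact hd')
  obtain ⟨v, rfl⟩ := (bijective_mfderiv_extChartAt hx).2 w
  have hv : v ≠ 0 := fun h => hw (by rw [h]; exact map_zero _)
  have h3 := (H.convex p.2 hp.2).strictly_convex x v hv
  rw [h1, h2] at h3
  exact h3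

/-- Each time slice, regarded as a stationary family. -/
theorem isNormalFlow_slice (H : IsDualFlow T φ ν) (hn : 2 ≤ n) (x₀ : M) {t : ℝ}
    (ht : t ∈ Ico 0 T) : IsNormalFlow ((𝕌 x₀) ×ˢ univ) (fun p => inChart x₀ φ (p.1, t))
      (fun p => inChart x₀ ν (p.1, t)) 0 := by
  have hU := isOpen_extChartAt_target (I := 𝓡 (n - 1)) x₀
  have hslice : ∀ g : EuclideanSpace ℝ (Fin (n - 1)) × ℝ → EuclideanSpace ℝ (Fin n),
      ContDiffOn ℝ ∞ g ((𝕌 x₀) ×ˢ Ico 0 T) → ∀ p ∈ (𝕌 x₀) ×ˢ (univ : Set ℝ),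
      ContDiffAt ℝ ∞ (fun p : EuclideanSpace ℝ (Fin (n - 1)) × ℝ => g (p.1, t)) p := by
    intro g hg p hp
    refine ContDiffOn.contDiffAt (s := (𝕌 x₀) ×ˢ univ) ?_ ((hU.prod isOpen_univ).mem_nhds hp)
    exact hg.comp (contDiff_fst.prodMk contDiff_const).contDiffOn fun q hq => ⟨hq.1, ht⟩
  have hderiv : ∀ p ∈ (𝕌 x₀) ×ˢ (univ : Set ℝ), HasFDerivAt
      (fun p : EuclideanSpace ℝ (Fin (n - 1)) × ℝ => inChart x₀ φ (p.1, t))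
      ((slabDeriv (𝕌 x₀) T (inChart x₀ φ) (p.1, t)).comp (ContinuousLinearMap.fst ℝ _ ℝ)) p := by
    intro p hp
    exact (hasFDerivAt_slabDeriv hU (H.contDiffOn_map x₀) hp.1 ht).comp p hasFDerivAt_fst
  refine ⟨hU.prod isOpen_univ, hslice _ (H.contDiffOn_map x₀), hslice _ (H.contDiffOn_normal hn x₀),
    fun _ _ => contDiffAt_const, fun p hp => (H.convex t ht).norm_normal _, fun p hp v => ?_,
    fun p hp => ?_⟩
  · rw [(hderiv p hp).fderiv]
    exact H.inner_slabDeriv_normal x₀ (p := (p.1, t)) ⟨hp.1, ht⟩ v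
  · rw [(hderiv p hp).fderiv]
    simp

/-- A frozen slice is a flow of speed zero on an open domain, so the symmetry also holds at t = 0,
where the flow itself is one-sided. -/
theorem second_form_symm (H : IsDualFlow T φ ν) (hn : 2 ≤ n) (x₀ : M)
    {p : EuclideanSpace ℝ (Fin (n - 1)) × ℝ} (hp : p ∈ (𝕌 x₀) ×ˢ Ico 0 T)
    (v w : EuclideanSpace ℝ (Fin (n - 1))) :
    ⟪slabDeriv (𝕌 x₀) T (inChart x₀ φ) p v, slabDeriv (𝕌 x₀) T (inChart x₀ ν) p w⟫ =
      ⟪slabDeriv (𝕌 x₀) T (inChart x₀ φ) p w, slabDeriv (𝕌 x₀) T (inChart x₀ ν) p v⟫ := by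
  have hU := isOpen_extChartAt_target (I := 𝓡 (n - 1)) x₀
  have h1 := (hasFDerivAt_slabDeriv hU (H.contDiffOn_map x₀) hp.1 hp.2).comp p hasFDerivAt_fst
  have h2 := (hasFDerivAt_slabDeriv hU (H.contDiffOn_normal hn x₀) hp.1 hp.2).comp p
    hasFDerivAt_fst
  have h := (H.isNormalFlow_slice hn x₀ hp.2).second_form_symm (p := p) ⟨hp.1, mem_univ _⟩ v w
  have e1 : fderiv ℝ (fun q : EuclideanSpace ℝ (Fin (n - 1)) × ℝ => inChart x₀ φ (q.1, p.2)) p =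
    _ := h1.fderiv
  have e2 : fderiv ℝ (fun q : EuclideanSpace ℝ (Fin (n - 1)) × ℝ => inChart x₀ ν (q.1, p.2)) p =
    _ := h2.fderiv
  rw [e1, e2] at h
  exact h

/-- The second fundamental form is positive definite in the coordinates around `x₀`, up to `t = 0`. -/
theorem det_second_form_pos (H : IsDualFlow T φ ν) (hn : 2 ≤ n) (x₀ : M)
    {p : EuclideanSpace ℝ (Fin (n - 1)) × ℝ} (hp : p ∈ (𝕌 x₀) ×ˢ Ico 0 T) :
    0 < (pairing (stdBasis n) (slabDeriv (𝕌 x₀) T (inChart x₀ φ) p)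
      (slabDeriv (𝕌 x₀) T (inChart x₀ ν) p)).det :=
  (posDef_pairing (stdBasis n) (slabDeriv (𝕌 x₀) T (inChart x₀ φ) p).toLinearMap
    (slabDeriv (𝕌 x₀) T (inChart x₀ ν) p).toLinearMap (H.second_form_symm hn x₀ hp)
    fun _ hv => H.second_form_pos hn x₀ hp hv).det_pos

theorem det_first_form_pos (H : IsDualFlow T φ ν) (x₀ : M)
    {p : EuclideanSpace ℝ (Fin (n - 1)) × ℝ} (hp : p ∈ (𝕌 x₀) ×ˢ Ico 0 T) :
    0 < (pairing (stdBasis n) (slabDeriv (𝕌 x₀) T (inChart x₀ φ) p)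
      (slabDeriv (𝕌 x₀) T (inChart x₀ φ) p)).det :=
  (posDef_first_form (stdBasis n) (P := (slabDeriv (𝕌 x₀) T (inChart x₀ φ) p).toLinearMap)
    (H.injective_slabDeriv x₀ hp)).det_pos

theorem gaussCurvature_eq (H : IsDualFlow T φ ν) (hn : 2 ≤ n) {x₀ x : M}
    (hx : x ∈ (extChartAt (𝓡 (n - 1)) x₀).source) {t : ℝ} (ht : t ∈ Ico 0 T) :
    gaussCurvature (fun y => φ y t) (fun y => ν y t) x =
      (pairing (stdBasis n) (slabDeriv (𝕌 x₀) T (inChart x₀ φ) (extChartAt (𝓡 (n - 1)) x₀ x, t))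
        (slabDeriv (𝕌 x₀) T (inChart x₀ ν) (extChartAt (𝓡 (n - 1)) x₀ x, t))).det /
      (pairing (stdBasis n) (slabDeriv (𝕌 x₀) T (inChart x₀ φ) (extChartAt (𝓡 (n - 1)) x₀ x, t))
        (slabDeriv (𝕌 x₀) T (inChart x₀ φ) (extChartAt (𝓡 (n - 1)) x₀ x, t))).det := by
  have hU := isOpen_extChartAt_target (I := 𝓡 (n - 1)) x₀
  have hz := (extChartAt (𝓡 (n - 1)) x₀).map_source hx
  have hd := hasFDerivAt_slabDeriv hU (H.contDiffOn_map x₀) hz ht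
  have hd' := hasFDerivAt_slabDeriv hU (H.contDiffOn_normal hn x₀) hz ht
  exact gaussCurvature_eq_of_comp
    (A := (mfderiv (𝓡 (n - 1)) 𝓘(ℝ, EuclideanSpace ℝ (Fin (n - 1)))
      (extChartAt (𝓡 (n - 1)) x₀) x).toLinearMap)
    (bijective_mfderiv_extChartAt hx)
    (diff_eq_of_hasFDerivAt hx (g := fun y => φ y t) hd)
    (diff_eq_of_hasFDerivAt hx (g := fun y => ν y t) hd')

end IsDualFlow

/-- With K = a / b, touching means K r^(2k+3) = λ u^(k+3). Bounding K by the mean curvature and u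
below by γr makes everything a multiple of r^(2k+3), which cancels. -/
theorem mul_le_of_trace_le {k : ℕ} {lam γ r u a b S H : ℝ} (hlam : 0 < lam) (hγ : 0 < γ)
    (hr : 0 < r) (hu : 0 < u) (hb : 0 < b) (hγu : γ * r ≤ u) (hH : 0 ≤ H)
    (hle : H ≤ (k + 1) * (k + 3) / u) (hmean : (k : ℝ) ^ k * (a / b) ≤ H ^ k)
    (heq : S * (r ^ (k + 1) * a) = u ^ (k + 3) * b) (hS : S = r ^ (k + 2) / lam) :
    (k : ℝ) ^ k * γ ^ (2 * k + 3) * lam ≤ (((k : ℝ) + 1) * (k + 3)) ^ k := by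
  have h1 : a / b * r ^ (2 * k + 3) = lam * u ^ (k + 3) := by
    rw [hS] at heq
    have h2 : r ^ (2 * k + 3) = r ^ (k + 2) * r ^ (k + 1) := by ring
    rw [h2]
    field_simp at heq ⊢
    linarith
  have h3 : H ^ k * u ^ k ≤ (((k : ℝ) + 1) * (k + 3)) ^ k := by
    rw [← mul_pow]
    exact pow_le_pow_left₀ (by positivity) ((le_div_iff₀ hu).1 hle) k
  have hrp : 0 < r ^ (2 * k + 3) := by positivity
  refine le_of_mul_le_mul_right ?_ hrp
  calc (k : ℝ) ^ k * γ ^ (2 * k + 3) * lam * r ^ (2 * k + 3)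
      = (k : ℝ) ^ k * lam * (γ * r) ^ (2 * k + 3) := by rw [mul_pow]; ring
    _ ≤ (k : ℝ) ^ k * lam * u ^ (2 * k + 3) := by gcongr
    _ = (k : ℝ) ^ k * (lam * u ^ (k + 3)) * u ^ k := by ring
    _ = (k : ℝ) ^ k * (a / b) * (u ^ k * r ^ (2 * k + 3)) := by rw [← h1]; ring
    _ ≤ H ^ k * (u ^ k * r ^ (2 * k + 3)) := by gcongr
    _ = H ^ k * u ^ k * r ^ (2 * k + 3) := by ring
    _ ≤ _ := by gcongr

/-! ### The maximum principle. -/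

namespace IsDualFlow

theorem inChart_map_ne_zero {n : ℕ} {M : Type*} [TopologicalSpace M]
    [ChartedSpace (EuclideanSpace ℝ (Fin (n - 1))) M] {T : ℝ}
    {φ ν : M → ℝ → EuclideanSpace ℝ (Fin n)} (H : IsDualFlow T φ ν) (x₀ : M)
    {p : EuclideanSpace ℝ (Fin (n - 1)) × ℝ}
    (hp : p ∈ (extChartAt (𝓡 (n - 1)) x₀).target ×ˢ Ico 0 T) : inChart x₀ φ p ≠ 0 :=
  (H.convex p.2 hp.2).ne_zero _

variable {n : ℕ} {M : Type*} [TopologicalSpace M]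
  [ChartedSpace (EuclideanSpace ℝ (Fin (n - 1))) M] [IsManifold (𝓡 (n - 1)) ∞ M]
  {T : ℝ} {φ ν : M → ℝ → EuclideanSpace ℝ (Fin n)}

local notation "𝕌" x₀ => PartialEquiv.target (extChartAt (𝓡 (n - 1)) x₀)

/-- The speed of the flow in coordinates around `x₀`. -/
noncomputable def chartSpeed (T : ℝ) (φ ν : M → ℝ → EuclideanSpace ℝ (Fin n)) (x₀ : M)
    (p : EuclideanSpace ℝ (Fin (n - 1)) × ℝ) : ℝ :=
  ⟪inChart x₀ φ p, inChart x₀ ν p⟫ ^ (n + 2) / ‖inChart x₀ φ p‖ ^ n *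
    (1 / ((pairing (stdBasis n) (slabDeriv (𝕌 x₀) T (inChart x₀ φ) p)
        (slabDeriv (𝕌 x₀) T (inChart x₀ ν) p)).det /
      (pairing (stdBasis n) (slabDeriv (𝕌 x₀) T (inChart x₀ φ) p)
        (slabDeriv (𝕌 x₀) T (inChart x₀ φ) p)).det))

theorem speed_eq_chartSpeed (H : IsDualFlow T φ ν) (hn : 2 ≤ n) {x₀ x : M}
    (hx : x ∈ (extChartAt (𝓡 (n - 1)) x₀).source) {t : ℝ} (ht : t ∈ Ico 0 T) :
    speed (fun y => φ y t) (fun y => ν y t) x =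
      chartSpeed T φ ν x₀ (extChartAt (𝓡 (n - 1)) x₀ x, t) := by
  rw [speed, chartSpeed, H.gaussCurvature_eq hn hx ht, inChart_apply x₀ φ hx,
    inChart_apply x₀ ν hx]

theorem contDiffOn_chartSpeed (H : IsDualFlow T φ ν) (hn : 2 ≤ n) (x₀ : M) :
    ContDiffOn ℝ ∞ (chartSpeed T φ ν x₀) ((𝕌 x₀) ×ˢ Ico 0 T) := by
  have hU := isOpen_extChartAt_target (I := 𝓡 (n - 1)) x₀
  have hf := H.contDiffOn_map x₀
  have hν := H.contDiffOn_normal hn x₀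
  have hP := contDiffOn_slabDeriv hU hf
  have hQ := contDiffOn_slabDeriv hU hν
  have hg : ∀ p ∈ (𝕌 x₀) ×ˢ Ico 0 T, _ := fun p hp => (H.det_first_form_pos x₀ hp).ne'
  have hh : ∀ p ∈ (𝕌 x₀) ×ˢ Ico 0 T, _ := fun p hp => (H.det_second_form_pos hn x₀ hp).ne'
  have hr : ContDiffOn ℝ ∞ (fun p => ‖inChart x₀ φ p‖) ((𝕌 x₀) ×ˢ Ico 0 T) :=
    hf.norm ℝ fun p hp => H.inChart_map_ne_zero x₀ hp
  refine (((hf.inner ℝ hν).pow _).div (hr.pow _) fun p hp => pow_ne_zero _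
    (norm_ne_zero_iff.2 (H.inChart_map_ne_zero x₀ hp))).mul
    (contDiffOn_const.div ((contDiffOn_det_pairing _ hP hQ).div (contDiffOn_det_pairing _ hP hP)
      hg) fun p hp => div_ne_zero (hh p hp) (hg p hp))

theorem gaussCurvature_pos (H : IsDualFlow T φ ν) (hn : 2 ≤ n) (x : M) {t : ℝ}
    (ht : t ∈ Ico 0 T) : 0 < gaussCurvature (fun y => φ y t) (fun y => ν y t) x := by
  have hx := mem_extChartAt_source (I := 𝓡 (n - 1)) x
  have hp : (extChartAt (𝓡 (n - 1)) x x, t) ∈ (𝕌 x) ×ˢ Ico 0 T :=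
    ⟨(extChartAt (𝓡 (n - 1)) x).map_source hx, ht⟩
  rw [H.gaussCurvature_eq hn hx ht]
  exact div_pos (H.det_second_form_pos hn x hp) (H.det_first_form_pos x hp)

theorem speed_pos (H : IsDualFlow T φ ν) (hn : 2 ≤ n) (x : M) {t : ℝ}
    (ht : t ∈ Ico 0 T) : 0 < speed (fun y => φ y t) (fun y => ν y t) x := by
  have h1 := H.gaussCurvature_pos hn x ht
  have h2 := (H.convex t ht).support_pos x
  have h3 : 0 < ‖φ x t‖ := norm_pos_iff.2 ((H.convex t ht).ne_zero x)
  rw [speed]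
  positivity

theorem continuousOn_speed (H : IsDualFlow T φ ν) (hn : 2 ≤ n) :
    ContinuousOn (fun p : M × ℝ => speed (fun y => φ y p.2) (fun y => ν y p.2) p.1)
      (univ ×ˢ Ico 0 T) := by
  rintro ⟨x₀, t⟩ ⟨-, ht⟩
  have hx₀ := mem_extChartAt_source (I := 𝓡 (n - 1)) x₀
  have hnhds : (extChartAt (𝓡 (n - 1)) x₀).source ×ˢ (univ : Set ℝ) ∈ 𝓝 (x₀, t) :=
    prod_mem_nhds (extChartAt_source_mem_nhds x₀) univ_mem
  have h1 : ContinuousOn (fun p : M × ℝ => chartSpeed T φ ν x₀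
      (extChartAt (𝓡 (n - 1)) x₀ p.1, p.2)) ((extChartAt (𝓡 (n - 1)) x₀).source ×ˢ Ico 0 T) := by
    refine (H.contDiffOn_chartSpeed hn x₀).continuousOn.comp
      (((continuousOn_extChartAt x₀).comp continuousOn_fst fun p hp => hp.1).prodMk
        continuousOn_snd) fun p hp => ⟨(extChartAt (𝓡 (n - 1)) x₀).map_source hp.1, hp.2⟩
  have h2 : ContinuousOn (fun p : M × ℝ => speed (fun y => φ y p.2) (fun y => ν y p.2) p.1)
      ((extChartAt (𝓡 (n - 1)) x₀).source ×ˢ Ico 0 T) :=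
    h1.congr fun p hp => H.speed_eq_chartSpeed hn hp.1 hp.2
  refine (h2 (x₀, t) ⟨hx₀, ht⟩).mono_of_mem_nhdsWithin ?_
  filter_upwards [nhdsWithin_le_nhds hnhds, self_mem_nhdsWithin] with p hp1 hp2
  exact ⟨hp1.1, hp2.2⟩

theorem continuousOn_chi (H : IsDualFlow T φ ν) (hn : 2 ≤ n) (lam : ℝ) :
    ContinuousOn (fun p : M × ℝ => chi lam (fun y => φ y p.2) (fun y => ν y p.2) p.1)
      (univ ×ˢ Ico 0 T) :=
  (H.smooth.continuousOn.norm.pow _).sub (continuousOn_const.mul (H.continuousOn_speed hn))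

theorem isNormalFlow (H : IsDualFlow T φ ν) (hn : 2 ≤ n) (x₀ : M) :
    IsNormalFlow ((𝕌 x₀) ×ˢ Ioo 0 T) (inChart x₀ φ) (inChart x₀ ν) (chartSpeed T φ ν x₀) := by
  have hU := isOpen_extChartAt_target (I := 𝓡 (n - 1)) x₀
  have hsub : ∀ p ∈ (𝕌 x₀) ×ˢ Ioo 0 T, p ∈ (𝕌 x₀) ×ˢ Ico 0 T := fun p hp =>
    ⟨hp.1, Ioo_subset_Ico_self hp.2⟩
  have hmap : ∀ p ∈ (𝕌 x₀) ×ˢ Ioo 0 T, ContDiffAt ℝ ∞ (inChart x₀ φ) p := fun p hp =>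
    (H.contDiffOn_map x₀).contDiffAt (slab_mem_nhds hU hp)
  refine ⟨hU.prod isOpen_Ioo, hmap,
    fun p hp => (H.contDiffOn_normal hn x₀).contDiffAt (slab_mem_nhds hU hp),
    fun p hp => (H.contDiffOn_chartSpeed hn x₀).contDiffAt (slab_mem_nhds hU hp),
    fun p hp => (H.convex p.2 (hsub p hp).2).norm_normal _, fun p hp v => ?_, fun p hp => ?_⟩
  · have h := H.inner_slabDeriv_normal x₀ (hsub p hp) v
    have he := congrArg (fun L => L v) (slabDeriv_eq_spatialDeriv hU (inChart x₀ φ) hp)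
    rw [← spatialDeriv_apply, ← he]
    exact h
  · set x := (extChartAt (𝓡 (n - 1)) x₀).symm p.1 with hxdef
    have hx : x ∈ (extChartAt (𝓡 (n - 1)) x₀).source :=
      (extChartAt (𝓡 (n - 1)) x₀).map_target hp.1
    have hxp : extChartAt (𝓡 (n - 1)) x₀ x = p.1 := (extChartAt (𝓡 (n - 1)) x₀).right_inv hp.1
    have h1 := hasDerivAt_prodMk_right ((hmap p hp).differentiableAt (by simp))
    have h2 := (H.flow p.2 (hsub p hp).2 x).hasDerivAt (Ico_mem_nhds hp.2.1 hp.2.2)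
    rw [H.speed_eq_chartSpeed hn hx (hsub p hp).2, hxp] at h2
    exact h1.unique h2

/-- At time `t > 0` the function `chi` cannot reach zero for the first time. -/
theorem chi_ne_zero_of_max (H : IsDualFlow T φ ν) (hn : 2 ≤ n) {γ lam : ℝ} (hγ0 : 0 < γ)
    (hγ1 : γ ≤ 1) (hγ : ∀ t ∈ Ico 0 T, ∀ x, γ * ‖φ x t‖ ≤ ⟪φ x t, ν x t⟫)
    (hlam : threshold n γ ≤ lam) {x₀ : M} {t₀ : ℝ} (ht₀ : t₀ ∈ Ioo 0 T)
    (hmax : ∀ t ∈ Ico 0 T, t ≤ t₀ → ∀ x, chi lam (fun y => φ y t) (fun y => ν y t) x ≤ 0) :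
    chi lam (fun y => φ y t₀) (fun y => ν y t₀) x₀ ≠ 0 := by
  intro hzero
  have hlam0 : 0 < lam := (threshold_pos hn hγ0).trans_le hlam
  have hU := isOpen_extChartAt_target (I := 𝓡 (n - 1)) x₀
  have ht₀' : t₀ ∈ Ico 0 T := Ioo_subset_Ico_self ht₀
  have hx₀ := mem_extChartAt_source (I := 𝓡 (n - 1)) x₀
  obtain ⟨k, rfl⟩ : ∃ k, n = k + 1 := ⟨n - 1, by omega⟩
  set p : EuclideanSpace ℝ (Fin (k + 1 - 1)) × ℝ := (extChartAt (𝓡 (k + 1 - 1)) x₀ x₀, t₀)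
    with hpdef
  have hp : p ∈ (extChartAt (𝓡 (k + 1 - 1)) x₀).target ×ˢ Ioo 0 T :=
    ⟨(extChartAt (𝓡 (k + 1 - 1)) x₀).map_source hx₀, ht₀⟩
  have hp' : p ∈ (extChartAt (𝓡 (k + 1 - 1)) x₀).target ×ˢ Ico 0 T := ⟨hp.1, ht₀'⟩
  have N := H.isNormalFlow hn x₀
  have hfp : inChart x₀ φ p = φ x₀ t₀ := inChart_apply x₀ φ hx₀ t₀
  have hνp : inChart x₀ ν p = ν x₀ t₀ := inChart_apply x₀ ν hx₀ t₀
  have hf0 := H.inChart_map_ne_zero x₀ hp'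
  have hu : 0 < ⟪inChart x₀ φ p, inChart x₀ ν p⟫ := (H.convex t₀ ht₀').support_pos _
  have hinj : Function.Injective (spatialDeriv (inChart x₀ φ) p) := by
    rw [← slabDeriv_eq_spatialDeriv hU _ hp]
    exact H.injective_slabDeriv x₀ hp'
  have hpos : ∀ v, v ≠ 0 →
      0 < ⟪spatialDeriv (inChart x₀ φ) p v, spatialDeriv (inChart x₀ ν) p v⟫ := by
    intro v hv
    rw [← slabDeriv_eq_spatialDeriv hU _ hp, ← slabDeriv_eq_spatialDeriv hU _ hp]
    exact H.second_form_pos hn x₀ hp' hv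
  have hSK : ∀ q ∈ (extChartAt (𝓡 (k + 1 - 1)) x₀).target ×ˢ Ioo 0 T,
      chartSpeed T φ ν x₀ q * (‖inChart x₀ φ q‖ ^ (k + 1) *
        (pairing (stdBasis (k + 1)) (spatialDeriv (inChart x₀ φ) q)
          (spatialDeriv (inChart x₀ ν) q)).det) =
        ⟪inChart x₀ φ q, inChart x₀ ν q⟫ ^ (k + 3) *
          (pairing (stdBasis (k + 1)) (spatialDeriv (inChart x₀ φ) q)
            (spatialDeriv (inChart x₀ φ) q)).det := by
    intro q hq
    have hq' : q ∈ (extChartAt (𝓡 (k + 1 - 1)) x₀).target ×ˢ Ico 0 T :=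
      ⟨hq.1, Ioo_subset_Ico_self hq.2⟩
    have h1 := (H.det_second_form_pos hn x₀ hq').ne'
    have h2 := (H.det_first_form_pos x₀ hq').ne'
    have h3 := norm_ne_zero_iff.2 (H.inChart_map_ne_zero x₀ hq')
    rw [← slabDeriv_eq_spatialDeriv hU _ hq, ← slabDeriv_eq_spatialDeriv hU _ hq]
    simp only [chartSpeed, ContinuousLinearMap.coe_coe]
    field_simp
  have hSeq : chartSpeed T φ ν x₀ p = ‖inChart x₀ φ p‖ ^ (k + 2) / lam := by
    rw [eq_div_iff hlam0.ne', hfp, ← H.speed_eq_chartSpeed hn hx₀ ht₀']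
    rw [chi] at hzero
    linarith
  have hmin : ∀ᶠ q in 𝓝 p, q.2 ≤ p.2 →
      ‖inChart x₀ φ q‖ ^ (k + 2) / lam ≤ chartSpeed T φ ν x₀ q := by
    filter_upwards [slab_mem_nhds hU hp] with q hq hle
    have hx := (extChartAt (𝓡 (k + 1 - 1)) x₀).map_target hq.1
    have hxq := (extChartAt (𝓡 (k + 1 - 1)) x₀).right_inv hq.1
    have h := hmax q.2 hq.2 hle ((extChartAt (𝓡 (k + 1 - 1)) x₀).symm q.1)
    rw [chi, H.speed_eq_chartSpeed hn hx hq.2, hxq] at h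
    rw [div_le_iff₀ hlam0]
    change ‖inChart x₀ φ q‖ ^ (k + 2) - lam * chartSpeed T φ ν x₀ q ≤ 0 at h
    linarith
  have htr := N.trace_le_of_touching hp hf0 hlam0 (stdBasis (k + 1)) (k := k) (by simp)
    (finrank_eq hn) hinj hpos hu hSK hSeq hmin
  have hk : 0 < k := by omega
  have hne : Nonempty (Fin (k + 1 - 1)) := ⟨⟨0, by omega⟩⟩
  have hg := posDef_first_form (stdBasis (k + 1)) hinj
  have hh := N.posDef_second_form hp (stdBasis (k + 1)) hpos
  have hmean := card_pow_mul_det_div_det_le hg hh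
  rw [Fintype.card_fin] at hmean
  have hle := mul_le_of_trace_le hlam0 hγ0 (norm_pos_iff.2 hf0) hu hg.det_pos
    (by rw [hfp, hνp]; exact hγ t₀ ht₀' x₀)
    (trace_mul_nonneg hg.inv.posSemidef hh.posSemidef) htr hmean (hSK p hp) hSeq
  have hlt := pow_lt_mul_of_threshold_le hn hγ0 hγ1 hlam
  rw [Nat.add_sub_cancel, show 2 * (k + 1) + 1 = 2 * k + 3 by ring] at hlt
  push_cast at hlt
  rw [add_sub_cancel_right, show (k : ℝ) + 1 + 2 = k + 3 by ring] at hlt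
  exact absurd hle (not_le.2 hlt)

/-- The maximum principle: `chi` stays negative. -/
theorem chi_neg [CompactSpace M] (H : IsDualFlow T φ ν) (hn : 2 ≤ n) {γ lam : ℝ} (hγ0 : 0 < γ)
    (hγ1 : γ ≤ 1) (hγ : ∀ t ∈ Ico 0 T, ∀ x, γ * ‖φ x t‖ ≤ ⟪φ x t, ν x t⟫)
    (hlam : threshold n γ ≤ lam)
    (hinit : ∀ x, chi lam (fun y => φ y 0) (fun y => ν y 0) x < 0) :
    ∀ t ∈ Ico 0 T, ∀ x, chi lam (fun y => φ y t) (fun y => ν y t) x < 0 := by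
  by_contra! hcon
  obtain ⟨t₁, ht₁, x₁, hx₁⟩ := hcon
  have hcont := H.continuousOn_chi hn lam
  have hsub : (univ : Set M) ×ˢ Icc 0 t₁ ⊆ univ ×ˢ Ico 0 T :=
    prod_mono_right fun t ht => ⟨ht.1, ht.2.trans_lt ht₁.2⟩
  have hcompact : IsCompact ((univ : Set M) ×ˢ Icc 0 t₁) := isCompact_univ.prod isCompact_Icc
  -- A point of this compact set with least time is a first violation.
  let C : Set (M × ℝ) := (univ ×ˢ Icc 0 t₁) ∩
    (fun p : M × ℝ => chi lam (fun y => φ y p.2) (fun y => ν y p.2) p.1) ⁻¹' Ici 0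
  have hC : IsCompact C := by
    obtain ⟨Z, hZ, hZeq⟩ := continuousOn_iff_isClosed.1 (hcont.mono hsub) (Ici 0) isClosed_Ici
    have : C = Z ∩ univ ×ˢ Icc 0 t₁ := by rw [← hZeq, inter_comm]
    rw [this, inter_comm]
    exact hcompact.inter_right hZ
  obtain ⟨⟨x₀, t₀⟩, ⟨⟨-, ht₀⟩, hx₀⟩, hleast⟩ :=
    hC.exists_isMinOn ⟨(x₁, t₁), ⟨mem_univ _, ht₁.1, le_rfl⟩, hx₁⟩ continuousOn_snd
  have ht₀T : t₀ < T := ht₀.2.trans_lt ht₁.2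
  have hbefore : ∀ t ∈ Ico 0 t₀, ∀ x, chi lam (fun y => φ y t) (fun y => ν y t) x < 0 := by
    intro t ht x
    by_contra! h
    exact absurd (isMinOn_iff.1 hleast (x, t) ⟨⟨mem_univ _, ht.1, ht.2.le.trans ht₀.2⟩, h⟩)
      (not_le.2 ht.2)
  have ht₀pos : 0 < t₀ := by
    refine lt_of_le_of_ne ht₀.1 fun h => ?_
    subst h
    exact absurd hx₀ (not_le.2 (hinit x₀))
  have hupto : ∀ t ∈ Ico 0 T, t ≤ t₀ →
      ∀ x, chi lam (fun y => φ y t) (fun y => ν y t) x ≤ 0 := by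
    intro t ht hle x
    rcases hle.lt_or_eq with hlt | rfl
    · exact (hbefore t ⟨ht.1, hlt⟩ x).le
    -- At the first violating time itself, nonpositivity at every point is a limit from earlier
    -- times.
    · have h1 : ContinuousOn (fun s => chi lam (fun y => φ y s) (fun y => ν y s) x) (Ico 0 T) :=
        ContinuousOn.comp
          (g := fun p : M × ℝ => chi lam (fun y => φ y p.2) (fun y => ν y p.2) p.1)
          (f := fun s : ℝ => (x, s)) hcont (Continuous.prodMk_right x).continuousOn
          fun s hs => ⟨mem_univ x, hs⟩
      have h2 : Tendsto (fun s => chi lam (fun y => φ y s) (fun y => ν y s) x) (𝓝[Ico 0 t] t)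
          (𝓝 (chi lam (fun y => φ y t) (fun y => ν y t) x)) :=
        (h1 t ht).mono_left (nhdsWithin_mono _ (Ico_subset_Ico_right ht₀T.le))
      have : (𝓝[Ico 0 t] t).NeBot := by
        rw [← mem_closure_iff_nhdsWithin_neBot, closure_Ico ht₀pos.ne]
        exact right_mem_Icc.2 ht₀pos.le
      refine le_of_tendsto h2 ?_
      filter_upwards [self_mem_nhdsWithin] with s hs using (hbefore s hs x).le
  exact H.chi_ne_zero_of_max hn hγ0 hγ1 hγ hlam ⟨ht₀pos, ht₀T⟩ hupto
    (le_antisymm (hupto t₀ ⟨ht₀.1, ht₀T⟩ le_rfl x₀) hx₀)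

/-- Cauchy–Schwarz gives ⟪φ, ν⟫ ≤ ‖φ‖, so the speed is at most ‖φ‖²/K; a factor ‖φ‖² then cancels.
-/
theorem norm_pow_le_of_chi_neg (H : IsDualFlow T φ ν) (hn : 2 ≤ n) {lam : ℝ} (hlam : 0 < lam)
    {t : ℝ} (ht : t ∈ Ico 0 T) {x : M}
    (hchi : chi lam (fun y => φ y t) (fun y => ν y t) x < 0) :
    ‖φ x t‖ ^ (n - 1) ≤ lam / gaussCurvature (fun y => φ y t) (fun y => ν y t) x := by
  have hK := H.gaussCurvature_pos hn x ht
  have hu := (H.convex t ht).support_pos x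
  have hr : 0 < ‖φ x t‖ := norm_pos_iff.2 ((H.convex t ht).ne_zero x)
  have hur : ⟪φ x t, ν x t⟫ ≤ ‖φ x t‖ := by
    have h := real_inner_le_norm (φ x t) (ν x t)
    rwa [(H.convex t ht).norm_normal x, mul_one] at h
  obtain ⟨k, rfl⟩ : ∃ k, n = k + 1 := ⟨n - 1, by omega⟩
  rw [chi, speed] at hchi
  set K := gaussCurvature (fun y => φ y t) (fun y => ν y t) x
  rw [Nat.add_sub_cancel]
  have h1 : ⟪φ x t, ν x t⟫ ^ (k + 1 + 2) / ‖φ x t‖ ^ (k + 1) ≤ ‖φ x t‖ ^ 2 := by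
    rw [div_le_iff₀ (by positivity), ← pow_add, show 2 + (k + 1) = k + 1 + 2 by ring]
    exact pow_le_pow_left₀ hu.le hur _
  have h2 : lam * (⟪φ x t, ν x t⟫ ^ (k + 1 + 2) / ‖φ x t‖ ^ (k + 1) * (1 / K)) ≤
      lam * (‖φ x t‖ ^ 2 * (1 / K)) := by gcongr
  have h3 : ‖φ x t‖ ^ k * ‖φ x t‖ ^ 2 ≤ lam / K * ‖φ x t‖ ^ 2 := by
    calc ‖φ x t‖ ^ k * ‖φ x t‖ ^ 2 = ‖φ x t‖ ^ (k + 1 + 1) := by ring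
      _ ≤ lam * (‖φ x t‖ ^ 2 * (1 / K)) := by linarith
      _ = lam / K * ‖φ x t‖ ^ 2 := by ring
  exact le_of_mul_le_mul_right h3 (by positivity)

/-- For large `lam`, the function `chi` is negative at the initial time. -/
theorem exists_chi_neg [CompactSpace M] (H : IsDualFlow T φ ν) (hn : 2 ≤ n) (hT : 0 < T)
    (c : ℝ) : ∃ lam, c ≤ lam ∧ ∀ x, chi lam (fun y => φ y 0) (fun y => ν y 0) x < 0 := by
  have h0 : (0 : ℝ) ∈ Ico 0 T := ⟨le_rfl, hT⟩
  have hS : Continuous fun x => speed (fun y => φ y 0) (fun y => ν y 0) x := by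
    rw [← continuousOn_univ]
    exact ContinuousOn.comp
      (g := fun p : M × ℝ => speed (fun y => φ y p.2) (fun y => ν y p.2) p.1)
      (f := fun x : M => (x, (0 : ℝ))) (H.continuousOn_speed hn)
      (Continuous.prodMk_left 0).continuousOn fun x _ => ⟨mem_univ x, h0⟩
  have hφ : Continuous fun x => φ x 0 := (H.convex 0 h0).smooth.continuous
  have hq : Continuous fun x =>
      ‖φ x 0‖ ^ (n + 1) / speed (fun y => φ y 0) (fun y => ν y 0) x :=
    (hφ.norm.pow _).div hS fun x => (H.speed_pos hn x h0).ne'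
  -- Negativity of χ means that λ exceeds this ratio, which is bounded by compactness; B + 1 makes
  -- the inequality strict.
  obtain ⟨B, hB⟩ := (isCompact_range hq).bddAbove
  refine ⟨max c (B + 1), le_max_left _ _, fun x => ?_⟩
  have h1 : ‖φ x 0‖ ^ (n + 1) / speed (fun y => φ y 0) (fun y => ν y 0) x < max c (B + 1) :=
    (hB (mem_range_self x)).trans_lt ((lt_add_one B).trans_le (le_max_right _ _))
  rw [div_lt_iff₀ (H.speed_pos hn x h0)] at h1
  rw [chi]
  linarith

end IsDualFlow

end DualFlow

theorem mainTheorem3 (n : ℕ) (hn : 2 ≤ n)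
    {M : Type*} [TopologicalSpace M] [CompactSpace M]
    [ChartedSpace (EuclideanSpace ℝ (Fin (n - 1))) M] [IsManifold (𝓡 (n - 1)) ∞ M]
    (T : ℝ) (hT : 0 < T) (φ ν : M → ℝ → EuclideanSpace ℝ (Fin n))
    (hflow : DualFlow.IsDualFlow T φ ν)
    (γ : ℝ) (hγ0 : 0 < γ) (hγ1 : γ ≤ 1)
    (hγ : ∀ t ∈ Set.Ico 0 T, ∀ x, γ * ‖φ x t‖ ≤ inner ℝ (φ x t) (ν x t)) :
    (∃ lam : ℝ, DualFlow.threshold n γ ≤ lam ∧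
      (∀ x, DualFlow.chi lam (fun y => φ y 0) (fun y => ν y 0) x < 0) ∧
      ∀ t ∈ Set.Ico 0 T, ∀ x, ‖φ x t‖ ^ (n - 1) ≤
        lam / DualFlow.gaussCurvature (fun y => φ y t) (fun y => ν y t) x) ∧
    (∀ lam : ℝ, DualFlow.threshold n γ ≤ lam →
      (∀ x, DualFlow.chi lam (fun y => φ y 0) (fun y => ν y 0) x < 0) →
      ∀ t ∈ Set.Ico 0 T, ∀ x, ‖φ x t‖ ^ (n - 1) ≤
        lam / DualFlow.gaussCurvature (fun y => φ y t) (fun y => ν y t) x) := by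
  have key : ∀ lam : ℝ, DualFlow.threshold n γ ≤ lam →
      (∀ x, DualFlow.chi lam (fun y => φ y 0) (fun y => ν y 0) x < 0) →
      ∀ t ∈ Set.Ico 0 T, ∀ x, ‖φ x t‖ ^ (n - 1) ≤
        lam / DualFlow.gaussCurvature (fun y => φ y t) (fun y => ν y t) x :=
    fun lam hlam hinit t ht x => hflow.norm_pow_le_of_chi_neg hn
      ((DualFlow.threshold_pos hn hγ0).trans_le hlam) ht
      (hflow.chi_neg hn hγ0 hγ1 hγ hlam hinit t ht x)
  obtain ⟨lam, hlam, hinit⟩ := hflow.exists_chi_neg hn hT (DualFlow.threshold n γ)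
  exact ⟨⟨lam, hlam, hinit, key lam hlam hinit⟩, key⟩
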